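/- For $N\ge 2$ let $k=k_N$ be an integer with $1\le k\le N/2$, let $p=p_N\in(1/2,1]$, $q=1-p$, $\lambda=p/q$, and assume the small-bias conditions $$\lim_{N\to\infty}\frac{N(p_N-q_N)}{\log k_N}=0,\qquad \lim_{N\to\infty}k_N=\infty .$$ Consider the asymmetric simple exclusion process with $k$ particles on $\{1,\dots,N\}$: the continuous-time Markov chain on $\{\xi\in\{0,1\}^N:\sum_x\xi(x)=k\}$ with generator $$\mathcal L f(\xi)=\sum_{y=1}^{N-1}\big(q\,\mathbf 1_{\{\xi(y)<\xi(y+1)\}}+p\,\mathbf 1_{\{\xi(y)>\xi(y+1)\}}\big)\big(f(\xi^{y})-f(\xi)\big),$$ where $\xi^y$ is $\xi$ with the contents of $y$ and $y+1$ exchanged; its semigroup is $P_t=e^{t\mathcal L}$. To a configuration $\xi$ associate the height function $h(x)=\sum_{y=1}^x(2\xi(y)-1)$, $0\le x\le N$. Let $h^\wedge_t$ and $h^\vee_t$ be the height functions at time $t$ of the process started from the configuration with the maximal height function $\wedge(x)=\min(x,2k-x)$ and from the one with the minimal height function $\vee(x)=\max(-x,x-2N+2k)$, respectively. Set $\varrho=(\sqrt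 p-\sqrt q)^2$ and $$\mathrm{gap}_N=\varrho+4\sqrt{pq}\,\sin^2\!\Big(\frac{\pi}{2N}\Big),$$ and (for $p<1$, which holds for all large $N$) let $a_{N,k}$ be the unique solution of $\sqrt{pq}\,\big(a(x+1)+a(x-1)-2a(x)\big)=\varrho\, a(x)$ for $1\le x\le N-1$, with $a(0)=1$ and $a(N)=\lambda^{(2k-N)/2}$. Define $$H_1(t,x)=\lambda^{\frac{N-k}2}\,\frac{\lambda^{\frac12h^\wedge_t(x)}-a_{N,k}(x)}{\lambda-1},\qquad H_2(t,x)=\lambda^{\frac{N-k}2}\,\frac{\lambda^{\frac12h^\vee_t(x)}-a_{N,k}(x)}{\lambda-1}.$$ Then for every $c>0$ there is $c'>0$ such that, for all $N$ large enough, $$\sup_{t\ge \frac{\log k}{2\,\mathrm{gap}_N}}\ \max_{i\in\{1,2\}}\ \mathbb P\Big(\max_{0\le x\le N}|H_i(t,x)|>k^{\frac12+c}\Big)\le e^{-k^{c'}} .$$ -/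

import Mathlib

open Filter Topology MeasureTheory

noncomputable section

namespace Exclusion

/-- Particle configurations on the segment with `N` sites and `k` particles.
The index `j : Fin N` stands for the site `j + 1`; `true` means that the site is occupied. -/
abbrev Config (N k : ℕ) : Type :=
  {ξ : Fin N → Bool // (Finset.univ.filter (fun x => ξ x = true)).card = k}

/-- The left end of the bond `{j + 1, j + 2}`. -/
def bondLeft {N : ℕ} (j : Fin (N - 1)) : Fin N := ⟨j.val, by have := j.isLt; omega⟩

/-- The right end of the bond `{j + 1, j + 2}`. -/
def bondRight {N : ℕ} (j : Fin (N - 1)) : Fin N := ⟨j.val + 1, by have := j.isLt; omega⟩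

/-- The configuration obtained by exchanging the contents of the two ends of a bond. -/
def flip {N k : ℕ} (ξ : Config N k) (j : Fin (N - 1)) : Config N k :=
  ⟨fun x => ξ.1 (Equiv.swap (bondLeft j) (bondRight j) x), by
    refine (Finset.card_equiv (Equiv.swap (bondLeft j) (bondRight j)) ?_).trans ξ.2
    intro x
    simp⟩

/-- Rate at which the bond `j` is updated: a particle jumps to the right at rate `p`
and to the left at rate `1 - p`, if the target site is empty. -/
def rate {N k : ℕ} (p : ℝ) (ξ : Config N k) (j : Fin (N - 1)) : ℝ :=
  (if ξ.1 (bondLeft j) < ξ.1 (bondRight j) then 1 - p else 0) +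
    (if ξ.1 (bondRight j) < ξ.1 (bondLeft j) then p else 0)

/-- The generator of the asymmetric simple exclusion process, as a linear operator on functions
of the configuration. -/
def generatorLin (N k : ℕ) (p : ℝ) : (Config N k → ℝ) →ₗ[ℝ] (Config N k → ℝ) where
  toFun f ξ := ∑ j : Fin (N - 1), rate p ξ j * (f (flip ξ j) - f ξ)
  map_add' f g := by
    funext ξ
    simp only [Pi.add_apply, ← Finset.sum_add_distrib]
    exact Finset.sum_congr rfl fun j _ => by ring
  map_smul' r f := by
    funext ξ
    simp only [Pi.smul_apply, smul_eq_mul, RingHom.id_apply, Finset.mul_sum]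
    exact Finset.sum_congr rfl fun j _ => by ring

/-- The generator, as a bounded operator (the space of functions is finite dimensional). -/
def generator (N k : ℕ) (p : ℝ) : (Config N k → ℝ) →L[ℝ] (Config N k → ℝ) :=
  LinearMap.toContinuousLinearMap (generatorLin N k p)

/-- The Markov semigroup `P_t = exp (t L)`. -/
def semigroup (N k : ℕ) (p t : ℝ) : (Config N k → ℝ) →L[ℝ] (Config N k → ℝ) :=
  NormedSpace.exp (t • generator N k p)

/-- The transition probability `P_t(ξ, A) = (P_t 1_A)(ξ)`. -/
def transProb {N k : ℕ} (p t : ℝ) (ξ : Config N k) (A : Set (Config N k)) : ℝ :=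
  semigroup N k p t (A.indicator fun _ => 1) ξ

/-- `η` is, under `P`, a continuous-time Markov chain with the above generator and initial state
`ξ`: its finite-dimensional distributions are those given by the semigroup (the case `n = 0` says that it
starts from `ξ` almost surely). (Path regularity is
not required, so that every version of the process is allowed.) -/
structure IsExclusionProcess {N k : ℕ} {Ω : Type*} [MeasurableSpace Ω] (p : ℝ) (ξ : Config N k)
    (P : Measure Ω) (η : ℝ → Ω → Config N k) : Prop where
  measurable : ∀ t, 0 ≤ t → Measurable (η t)
  law : ∀ (n : ℕ) (s : ℕ → ℝ) (x : ℕ → Config N k), Monotone s → s 0 = 0 → x 0 = ξ →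
    P.real {ω | ∀ i ≤ n, η (s i) ω = x i} =
      ∏ i ∈ Finset.range n, transProb p (s (i + 1) - s i) (x i) {x (i + 1)}

/-- The height function `h(ξ)(x) = ∑_{y = 1}^x (2 ξ(y) - 1)`, for `0 ≤ x ≤ N`. -/
def height {N k : ℕ} (ξ : Config N k) (x : ℕ) : ℤ :=
  ∑ y : Fin N, if y.val < x then (if ξ.1 y = true then 1 else -1) else 0

/-- The maximal height function `x ∧ (2k - x)`. -/
def wedge (k x : ℕ) : ℤ := min (x : ℤ) (2 * (k : ℤ) - x)

/-- The minimal height function `(-x) ∨ (x - 2N + 2k)`. -/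
def vee (N k x : ℕ) : ℤ := max (-(x : ℤ)) ((x : ℤ) - 2 * N + 2 * k)

/-- `ξ` is the configuration whose height function is the maximal one. -/
def IsMaxConfig {N k : ℕ} (ξ : Config N k) : Prop := ∀ x ≤ N, height ξ x = wedge k x

/-- `ξ` is the configuration whose height function is the minimal one. -/
def IsMinConfig {N k : ℕ} (ξ : Config N k) : Prop := ∀ x ≤ N, height ξ x = vee N k x

/-- `λ = p / q`. -/
def lam (p : ℝ) : ℝ := p / (1 - p)

/-- `ϱ = (√p - √q)²`. -/
def rho (p : ℝ) : ℝ := (√p - √(1 - p)) ^ 2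

/-- The spectral gap of the generator. -/
def gap (N : ℕ) (p : ℝ) : ℝ :=
  rho p + 4 * √(p * (1 - p)) * Real.sin (Real.pi / (2 * N)) ^ 2

/-- The boundary value problem `(√(pq) Δ - ϱ) a = 0` in `{1, …, N - 1}`, `a(0) = 1`,
`a(N) = λ^{(2k - N)/2}`. -/
structure IsProfile (N k : ℕ) (p : ℝ) (a : ℕ → ℝ) : Prop where
  eq : ∀ x, 1 ≤ x → x ≤ N - 1 →
    √(p * (1 - p)) * (a (x + 1) + a (x - 1) - 2 * a x) - rho p * a x = 0
  left : a 0 = 1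
  right : a N = lam p ^ ((2 * (k : ℝ) - N) / 2)

/-- The solution `a_{N,k}` of the boundary value problem `IsProfile`, in closed form; see
`isProfile_profile` and `IsProfile.eq_profile` for the proof that it is the unique solution. -/
def profile (N k : ℕ) (p : ℝ) (x : ℕ) : ℝ :=
  ((lam p ^ k - 1) * √(lam p) ^ x + (lam p ^ N - lam p ^ k) * (√(lam p))⁻¹ ^ x) / (lam p ^ N - 1)

/-- The weighted height deviation
`λ^{(N-k)/2} (λ^{h(x)/2} - a_{N,k}(x)) / (λ - 1)` of a configuration, at `x`. -/
def dev {N k : ℕ} (p : ℝ) (ξ : Config N k) (x : ℕ) : ℝ :=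
  lam p ^ (((N : ℝ) - k) / 2) *
    ((lam p ^ ((height ξ x : ℝ) / 2) - profile N k p x) / (lam p - 1))

/-- `max_{0 ≤ x ≤ N}` of the absolute value of the weighted height deviation. -/
def maxDev {N k : ℕ} (p : ℝ) (ξ : Config N k) : ℝ :=
  (Finset.range (N + 1)).sup' Finset.nonempty_range_add_one (fun x => |dev p ξ x|)

/-! Checks of the definitions: the profile is the unique solution of its boundary value problem,
and the extremal configurations exist and have the stated height functions. -/

theorem one_lt_lam {p : ℝ} (hp : 1 / 2 < p) (hp1 : p < 1) : 1 < lam p := by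
  unfold lam
  rw [lt_div_iff₀ (by linarith)]
  linarith

/-- The equation of the profile, as a recursion. -/
theorem profile_eq_iff {p : ℝ} (hp : 1 / 2 < p) (hp1 : p < 1) (u v w : ℝ) :
    √(p * (1 - p)) * (u + v - 2 * w) - rho p * w = 0 ↔
      u + v = (√(lam p) + (√(lam p))⁻¹) * w := by
  have hq : 0 < 1 - p := by linarith
  have hp0 : 0 < p := by linarith
  have hα : 0 < √p := Real.sqrt_pos.2 hp0
  have hβ : 0 < √(1 - p) := Real.sqrt_pos.2 hq
  have hα2 : √p ^ 2 = p := Real.sq_sqrt hp0.le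
  have hβ2 : √(1 - p) ^ 2 = 1 - p := Real.sq_sqrt hq.le
  unfold rho lam
  rw [Real.sqrt_mul hp0.le, Real.sqrt_div hp0.le]
  generalize √p = α at *
  generalize √(1 - p) = β at *
  have key : α * β * (u + v - 2 * w) - (α - β) ^ 2 * w
      = α * β * ((u + v) - (α / β + (α / β)⁻¹) * w) := by
    field_simp
    ring
  rw [key, mul_eq_zero, sub_eq_zero]
  have : α * β ≠ 0 := by positivity
  simp [this]

theorem isProfile_profile {N k : ℕ} {p : ℝ} (hN : 1 ≤ N) (hp : 1 / 2 < p) (hp1 : p < 1) :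
    IsProfile N k p (profile N k p) := by
  have hl := one_lt_lam hp hp1
  have hl0 : 0 < lam p := by linarith
  have hlN : lam p ^ N - 1 ≠ 0 := by
    have := one_lt_pow₀ hl (by omega : N ≠ 0)
    linarith
  have hr : 0 < √(lam p) := Real.sqrt_pos.2 hl0
  refine ⟨?_, ?_, ?_⟩
  · intro x hx _
    rw [profile_eq_iff hp hp1]
    obtain ⟨y, rfl⟩ : ∃ y, x = y + 1 := ⟨x - 1, by omega⟩
    unfold profile
    simp only [Nat.add_sub_cancel]
    have hri : √(lam p) * (√(lam p))⁻¹ = 1 := mul_inv_cancel₀ hr.ne'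
    generalize (√(lam p))⁻¹ = r' at *
    generalize √(lam p) = r at *
    rw [← add_div, ← mul_div_assoc]
    congr 1
    linear_combination (-(lam p ^ k - 1) * r ^ y - (lam p ^ N - lam p ^ k) * r' ^ y) * hri
  · unfold profile
    simp only [pow_zero, mul_one]
    rw [div_eq_one_iff_eq hlN]
    ring
  · have hsq : √(lam p) * √(lam p) = lam p := Real.mul_self_sqrt hl0.le
    have e1 : lam p ^ ((2 * (k : ℝ) - N) / 2) = lam p ^ k / √(lam p) ^ N := by
      rw [show (2 * (k : ℝ) - N) / 2 = (k : ℝ) - (1 / 2 : ℝ) * N by ring, Real.rpow_sub hl0,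
        Real.rpow_natCast, Real.rpow_mul hl0.le, Real.rpow_natCast, ← Real.sqrt_eq_rpow]
    rw [e1]
    unfold profile
    have e2 : lam p ^ N = √(lam p) ^ N * √(lam p) ^ N := by rw [← mul_pow, hsq]
    rw [div_eq_div_iff hlN (by positivity), inv_pow, e2]
    have : √(lam p) ^ N ≠ 0 := by positivity
    field_simp
    ring

theorem IsProfile.eq_profile {N k : ℕ} {p : ℝ} (hN : 1 ≤ N) (hp : 1 / 2 < p) (hp1 : p < 1)
    {a : ℕ → ℝ} (ha : IsProfile N k p a) : ∀ x ≤ N, a x = profile N k p x := by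
  have hb := isProfile_profile (k := k) hN hp hp1
  have hl := one_lt_lam hp hp1
  have hr1 : 1 < √(lam p) := by
    rw [Real.lt_sqrt zero_le_one]; simpa using hl
  set r := √(lam p) with hrdef
  have hr : 0 < r := by linarith
  set d : ℕ → ℝ := fun x => a x - profile N k p x with hd
  have d0 : d 0 = 0 := by simp [hd, ha.left, hb.left]
  have dN : d N = 0 := by simp [hd, ha.right, hb.right]
  have hrec : ∀ x, x + 2 ≤ N → d (x + 2) = (r + r⁻¹) * d (x + 1) - d x := by
    intro x hx
    have h1 := (profile_eq_iff hp hp1 _ _ _).1 (ha.eq (x + 1) (by omega) (by omega))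
    have h2 := (profile_eq_iff hp hp1 _ _ _).1 (hb.eq (x + 1) (by omega) (by omega))
    simp only [Nat.add_sub_cancel] at h1 h2
    simp only [hd]
    rw [← hrdef] at h1 h2
    have e : x + 1 + 1 = x + 2 := rfl
    rw [e] at h1 h2
    linarith
  have hform : ∀ x, x ≤ N → (r - r⁻¹) * d x = d 1 * (r ^ x - r⁻¹ ^ x) ∧
      (x + 1 ≤ N → (r - r⁻¹) * d (x + 1) = d 1 * (r ^ (x + 1) - r⁻¹ ^ (x + 1))) := by
    intro x
    induction x with
    | zero =>
      intro _
      refine ⟨by simp [d0], fun _ => ?_⟩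
      simp
      ring
    | succ x ih =>
      intro hx
      obtain ⟨h1, h2⟩ := ih (by omega)
      refine ⟨h2 hx, fun hx2 => ?_⟩
      have h3 := h2 hx
      have e : x + 1 + 1 = x + 2 := rfl
      rw [e, hrec x (by omega)]
      calc (r - r⁻¹) * ((r + r⁻¹) * d (x + 1) - d x)
          = (r + r⁻¹) * ((r - r⁻¹) * d (x + 1)) - (r - r⁻¹) * d x := by ring
        _ = d 1 * (r ^ (x + 2) - r⁻¹ ^ (x + 2)) := by
            rw [h3, h1]
            have : r * r⁻¹ = 1 := mul_inv_cancel₀ hr.ne'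
            have e1 : r ^ x = r ^ (x + 1) * r⁻¹ := by
              rw [pow_succ, mul_assoc, this, mul_one]
            have e2 : r⁻¹ ^ x = r⁻¹ ^ (x + 1) * r := by
              rw [pow_succ, mul_assoc, mul_comm r⁻¹ r, this, mul_one]
            rw [e1, e2]
            ring
  have hinv : r⁻¹ < 1 := inv_lt_one_of_one_lt₀ hr1
  have hpos : 0 < r ^ N - r⁻¹ ^ N := by
    have h1 := one_lt_pow₀ hr1 (by omega : N ≠ 0)
    have h2 : r⁻¹ ^ N < 1 := pow_lt_one₀ (by positivity) hinv (by omega)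
    linarith
  have d1 : d 1 = 0 := by
    have := (hform N le_rfl).1
    rw [dN, mul_zero] at this
    rcases mul_eq_zero.1 this.symm with h | h
    · exact h
    · linarith
  intro x hx
  have := (hform x hx).1
  rw [d1, zero_mul] at this
  rcases mul_eq_zero.1 this with h | h
  · linarith
  · have : d x = 0 := h
    simp only [hd] at this
    linarith

theorem height_zero {N k : ℕ} (ξ : Config N k) : height ξ 0 = 0 := by simp [height]

theorem height_succ {N k : ℕ} (ξ : Config N k) (x : ℕ) (hx : x < N) :
    height ξ (x + 1) = height ξ x + if ξ.1 ⟨x, hx⟩ = true then 1 else -1 := by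
  unfold height
  have : ∀ y : Fin N, (if y.val < x + 1 then (if ξ.1 y = true then (1 : ℤ) else -1) else 0)
      = (if y.val < x then (if ξ.1 y = true then (1 : ℤ) else -1) else 0)
        + if y = ⟨x, hx⟩ then (if ξ.1 y = true then (1 : ℤ) else -1) else 0 := by
    intro y
    have e : y = ⟨x, hx⟩ ↔ y.val = x := by rw [Fin.ext_iff]
    simp only [e]
    split_ifs <;> omega
  rw [Finset.sum_congr rfl fun y _ => this y, Finset.sum_add_distrib]
  simp

theorem exists_isMaxConfig {N k : ℕ} (hk : k ≤ N) : ∃ ξ : Config N k, IsMaxConfig ξ := by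
  refine ⟨⟨fun x => decide (x.val < k), ?_⟩, ?_⟩
  · simp [Fin.card_filter_val_lt, hk]
  · intro x
    induction x with
    | zero => intro _; simp [height_zero, wedge]
    | succ x ih =>
      intro hx
      rw [height_succ _ x (by omega), ih (by omega)]
      simp only [wedge, decide_eq_true_eq]
      split_ifs <;> omega

theorem exists_isMinConfig {N k : ℕ} (hk : k ≤ N) : ∃ ξ : Config N k, IsMinConfig ξ := by
  refine ⟨⟨fun x => decide (N - k ≤ x.val), ?_⟩, ?_⟩
  · simp only [decide_eq_true_eq]
    have h := Finset.card_filter_add_card_filter_not (s := (Finset.univ : Finset (Fin N)))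
      (fun x => N - k ≤ x.val)
    simp only [not_le, Fin.card_filter_val_lt, Finset.card_univ, Fintype.card_fin] at h
    omega
  · intro x
    induction x with
    | zero => intro _; simp only [height_zero, vee]; omega
    | succ x ih =>
      intro hx
      rw [height_succ _ x (by omega), ih (by omega)]
      simp only [vee, decide_eq_true_eq]
      split_ifs <;> omega

end Exclusion

end

/-! Give a particle with n particles on its left the weight λ^n. The weighted number of particles
among the first x sites is then a geometric sum, (λ^count - 1)/(λ - 1), and its distance from
equilibrium, `excess`, is the weighted height deviation up to a positive factor at most λ^N
(`dev_eq`, `abs_dev_le`). Small bias gives λ^N ≤ k^ε eventually, for each ε > 0, so bounded powers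
of λ^N are harmless.

With these weights (a discrete Hopf-Cole transform) exclusion is compared with independent walks. If
Q solves the backward equation of a single walk and c ≥ λ^k, the exponential of the weighted sum of
c⁻¹ log Q is a supersolution of the backward equation of the exclusion process
(`generator_exp_pairing_le`, `semigroup_exp_pairing_le`). Hence the exponential moments are of
Poisson type: the exponent is the mean shift of the walks plus a quadratic term of order s² k, up to
powers of λ^N (`semigroup_exp_excess_le`).

The mean shift, as a function of x, solves a linear Dirichlet problem. A cosine of frequency (1 -
ε)π/N, tilted by √λ^x, shows that it decays at rate at least (1 - ε)² gap
(`abs_pairing_exp_walk_sub_le`, `mul_gap_le`). From size k it falls to k^(1/2 + O(ε)) by time log k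
/ (2 gap). A Chernoff bound with s of order k^(-1/2 - 2ε) then controls k + 1 grid sites, and
monotonicity in x controls the sites between them. -/

namespace Exclusion

/-! ### Positive semigroups and comparison principles -/

section Positivity

variable {ι : Type*} [Fintype ι]

theorem exp_nonneg_of_nonneg {B : (ι → ℝ) →L[ℝ] (ι → ℝ)} (hB : ∀ f, 0 ≤ f → 0 ≤ B f)
    {f : ι → ℝ} (hf : 0 ≤ f) : 0 ≤ NormedSpace.exp B f := by
  have h := NormedSpace.exp_series_hasSum_exp' (𝕂 := ℝ) B
  have h2 := (ContinuousLinearMap.apply ℝ (ι → ℝ) f).hasSum h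
  refine h2.nonneg fun n => ?_
  have hp : 0 ≤ (B ^ n) f := by
    induction n with
    | zero => simpa using hf
    | succ n ih =>
      rw [pow_succ']
      exact hB _ ih
  have : (0 : ℝ) ≤ ((n.factorial : ℝ))⁻¹ := by positivity
  simpa using smul_nonneg this hp

/-- A generator with nonnegative off-diagonal rates generates a positivity preserving semigroup. -/
theorem exp_smul_nonneg {A : (ι → ℝ) →L[ℝ] (ι → ℝ)} {C : ℝ}
    (hA : ∀ f, 0 ≤ f → 0 ≤ A f + C • f) {t : ℝ} (ht : 0 ≤ t)
    {f : ι → ℝ} (hf : 0 ≤ f) : 0 ≤ NormedSpace.exp (t • A) f := by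
  -- Uniformization: the shifted operator preserves positivity, so every term of its exponential
  -- series does, and the shift only costs a scalar factor.
  set B : (ι → ℝ) →L[ℝ] (ι → ℝ) := t • A + (t * C) • 1 with hB
  have h1 : t • A = (-(t * C)) • (1 : (ι → ℝ) →L[ℝ] (ι → ℝ)) + B := by
    rw [hB]; module
  have hc : Commute ((-(t * C)) • (1 : (ι → ℝ) →L[ℝ] (ι → ℝ))) B :=
    (Commute.one_left B).smul_left _
  have h2 : NormedSpace.exp ((-(t * C)) • (1 : (ι → ℝ) →L[ℝ] (ι → ℝ)))
      = Real.exp (-(t * C)) • (1 : (ι → ℝ) →L[ℝ] (ι → ℝ)) := by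
    rw [← Algebra.algebraMap_eq_smul_one, ← Algebra.algebraMap_eq_smul_one,
      ← NormedSpace.algebraMap_exp_comm, Real.exp_eq_exp_ℝ]
  let : NormedAlgebra ℚ ((ι → ℝ) →L[ℝ] ι → ℝ) := .restrictScalars ℚ ℝ _
  rw [h1, NormedSpace.exp_add_of_commute hc, h2]
  have hBpos : ∀ g : ι → ℝ, 0 ≤ g → 0 ≤ B g := by
    intro g hg
    have : B g = t • (A g + C • g) := by
      simp [hB, smul_smul]
    rw [this]
    exact smul_nonneg ht (hA g hg)
  have := exp_nonneg_of_nonneg hBpos hf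
  simpa using smul_nonneg (Real.exp_pos (-(t * C))).le this

theorem exp_smul_mono {A : (ι → ℝ) →L[ℝ] (ι → ℝ)} {C : ℝ}
    (hA : ∀ f, 0 ≤ f → 0 ≤ A f + C • f) {t : ℝ} (ht : 0 ≤ t)
    {f g : ι → ℝ} (hfg : f ≤ g) : NormedSpace.exp (t • A) f ≤ NormedSpace.exp (t • A) g := by
  have := exp_smul_nonneg hA ht (sub_nonneg.2 hfg)
  rwa [map_sub, sub_nonneg] at this

theorem hasDerivAt_exp_smul_apply (A : (ι → ℝ) →L[ℝ] (ι → ℝ)) (f : ι → ℝ) (s : ℝ) :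
    HasDerivAt (fun s => NormedSpace.exp (s • A) f) (A (NormedSpace.exp (s • A) f)) s := by
  have h := hasDerivAt_exp_smul_const' (𝕂 := ℝ) A s
  exact ((ContinuousLinearMap.apply ℝ (ι → ℝ) f).hasFDerivAt.comp_hasDerivAt s h)

/-- A supersolution of the backward equation dominates the semigroup. -/
theorem exp_smul_apply_le_of_supersolution {A : (ι → ℝ) →L[ℝ] (ι → ℝ)} {C : ℝ}
    (hA : ∀ f, 0 ≤ f → 0 ≤ A f + C • f) {t : ℝ} (ht : 0 ≤ t) {F F' : ℝ → ι → ℝ}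
    (hF : ∀ s ∈ Set.Icc 0 t, HasDerivAt F (F' s) s)
    (hle : ∀ s ∈ Set.Icc 0 t, F' s + A (F s) ≤ 0) :
    NormedSpace.exp (t • A) (F t) ≤ F 0 := by
  have hd : ∀ s ∈ Set.Icc 0 t, HasDerivAt (fun s => NormedSpace.exp (s • A) (F s))
      (NormedSpace.exp (s • A) (F' s + A (F s))) s := by
    intro s hs
    have h := hasDerivAt_exp_smul_const (𝕂 := ℝ) A s
    have := h.clm_apply (hF s hs)
    have e : NormedSpace.exp (s • A) (F' s + A (F s))
        = (NormedSpace.exp (s • A) * A) (F s) + NormedSpace.exp (s • A) (F' s) := by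
      simp [add_comm]
    rw [e]
    exact this
  intro i
  have hd' : ∀ s ∈ Set.Icc 0 t, HasDerivAt (fun s => NormedSpace.exp (s • A) (F s) i)
      (NormedSpace.exp (s • A) (F' s + A (F s)) i) s := fun s hs => hasDerivAt_pi.1 (hd s hs) i
  -- Interpolation between `F 0` and the semigroup applied to `F t`: the derivative is the positive
  -- semigroup applied to a nonpositive function.
  have hanti : AntitoneOn (fun s => NormedSpace.exp (s • A) (F s) i) (Set.Icc 0 t) := by
    refine antitoneOn_of_deriv_nonpos (convex_Icc 0 t)
      (fun s hs => (hd' s hs).continuousAt.continuousWithinAt)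
      (fun s hs => (hd' s (interior_subset hs)).differentiableAt.differentiableWithinAt) ?_
    intro s hs
    have hs' := interior_subset hs
    rw [(hd' s hs').deriv]
    have := exp_smul_mono hA hs'.1 (hle s hs')
    rw [map_zero] at this
    exact this i
  have := hanti (Set.left_mem_Icc.2 ht) (Set.right_mem_Icc.2 ht) ht
  simpa using this

theorem exp_smul_apply_eq_of_eq_zero {A : (ι → ℝ) →L[ℝ] (ι → ℝ)} {f : ι → ℝ} (hf : A f = 0)
    (t : ℝ) : NormedSpace.exp (t • A) f = f := by
  have hd : ∀ s : ℝ, HasDerivAt (fun s : ℝ => NormedSpace.exp (s • A) f) 0 s := by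
    intro s
    have h := (ContinuousLinearMap.apply ℝ (ι → ℝ) f).hasFDerivAt.comp_hasDerivAt s
      (hasDerivAt_exp_smul_const (𝕂 := ℝ) A s)
    simpa [Function.comp_def, hf] using! h
  have h := is_const_of_deriv_eq_zero (fun s => (hd s).differentiableAt) (fun s => (hd s).deriv) t 0
  simpa using h

/-- The maximum principle: a subsolution of the forward equation stays nonpositive. -/
theorem nonpos_of_subsolution {A : (ι → ℝ) →L[ℝ] (ι → ℝ)} {C : ℝ}
    (hA : ∀ f, 0 ≤ f → 0 ≤ A f + C • f) {t : ℝ} (ht : 0 ≤ t) {b b' : ℝ → ι → ℝ}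
    (hb : ∀ s, HasDerivAt b (b' s) s) (hle : ∀ s ∈ Set.Icc 0 t, b' s ≤ A (b s)) (h0 : b 0 ≤ 0) :
    b t ≤ 0 := by
  -- Reversing time and sign turns a forward subsolution into a backward supersolution.
  have h := exp_smul_apply_le_of_supersolution hA ht (F := fun s => -b (t - s))
    (F' := fun s => b' (t - s))
    (fun s _ => by
      have := ((hb (t - s)).scomp s ((hasDerivAt_id s).const_sub t)).neg
      simpa [Function.comp_def] using! this)
    (fun s hs => by
      have := hle (t - s) ⟨by linarith [hs.2], by linarith [hs.1]⟩
      simp only [map_neg]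
      simpa [sub_eq_add_neg] using sub_nonpos.2 this)
  simp only [sub_self, sub_zero, map_neg] at h
  have h2 := exp_smul_mono hA ht h0
  rw [map_zero] at h2
  exact (neg_le_neg_iff.1 h).trans h2

end Positivity

/-! ### Weighted particle sums and the single walk -/

section Weights

variable {N k : ℕ}

theorem bondLeft_ne_bondRight (j : Fin (N - 1)) : bondLeft j ≠ bondRight j := by
  simp [bondLeft, bondRight, Fin.ext_iff]

/-- The number of particles among the first `x` sites. -/
def count (ξ : Config N k) (x : ℕ) : ℕ :=
  (Finset.univ.filter fun z : Fin N => z.val < x ∧ ξ.1 z = true).card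

theorem count_zero (ξ : Config N k) : count ξ 0 = 0 := by simp [count]

theorem count_le (ξ : Config N k) (x : ℕ) : count ξ x ≤ k := by
  conv_rhs => rw [← ξ.2]
  exact Finset.card_le_card fun z hz => by
    simp only [Finset.mem_filter] at hz ⊢
    exact ⟨hz.1, hz.2.2⟩

theorem count_self (ξ : Config N k) : count ξ N = k := by
  conv_rhs => rw [← ξ.2]
  simp [count]

theorem count_succ (ξ : Config N k) (y : Fin N) :
    count ξ (y.val + 1) = count ξ y.val + if ξ.1 y = true then 1 else 0 := by
  have h : (Finset.univ.filter fun z : Fin N => z.val < y.val + 1 ∧ ξ.1 z = true)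
      = (Finset.univ.filter fun z : Fin N => z.val < y.val ∧ ξ.1 z = true)
        ∪ (Finset.univ.filter fun z : Fin N => z = y ∧ ξ.1 z = true) := by
    ext z
    simp only [Finset.mem_filter, Finset.mem_univ, true_and, Finset.mem_union, Fin.ext_iff,
      Nat.lt_succ_iff_lt_or_eq]
    tauto
  have hd : Disjoint (Finset.univ.filter fun z : Fin N => z.val < y.val ∧ ξ.1 z = true)
      (Finset.univ.filter fun z : Fin N => z = y ∧ ξ.1 z = true) := by
    rw [Finset.disjoint_left]
    intro z hz hz'
    simp only [Finset.mem_filter, Finset.mem_univ, true_and, Fin.ext_iff] at hz hz'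
    omega
  unfold count
  rw [h, Finset.card_union_of_disjoint hd]
  congr 1
  by_cases hy : ξ.1 y = true
  · rw [if_pos hy, Finset.card_eq_one]
    refine ⟨y, ?_⟩
    ext z
    simp only [Finset.mem_filter, Finset.mem_univ, true_and, Finset.mem_singleton]
    exact ⟨fun h => h.1, fun h => ⟨h, h ▸ hy⟩⟩
  · rw [if_neg hy, Finset.card_eq_zero, Finset.filter_eq_empty_iff]
    rintro z - ⟨hz, hξ⟩
    exact hy (hz ▸ hξ)

theorem flip_apply (ξ : Config N k) (j : Fin (N - 1)) (x : Fin N) :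
    (flip ξ j).1 x = ξ.1 (Equiv.swap (bondLeft j) (bondRight j) x) := rfl

theorem count_flip (ξ : Config N k) (j : Fin (N - 1)) {x : ℕ} (hx : x ≠ j.val + 1) :
    count (flip ξ j) x = count ξ x := by
  unfold count
  refine Finset.card_equiv (Equiv.swap (bondLeft j) (bondRight j)) ?_
  intro z
  rw [Finset.mem_filter, Finset.mem_filter, flip_apply]
  refine and_congr (by simp) (and_congr ?_ Iff.rfl)
  rcases eq_or_ne z (bondLeft j) with rfl | h1
  · rw [Equiv.swap_apply_left]; simp only [bondLeft, bondRight]; omega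
  rcases eq_or_ne z (bondRight j) with rfl | h2
  · rw [Equiv.swap_apply_right]; simp only [bondLeft, bondRight]; omega
  rw [Equiv.swap_apply_of_ne_of_ne h1 h2]

/-- A particle at `y` has weight `λ ^ n`, where `n` is the number of particles on its left. -/
noncomputable def weight (p : ℝ) (ξ : Config N k) (y : Fin N) : ℝ :=
  if ξ.1 y = true then lam p ^ count ξ y.val else 0

/-- The weighted sum of `g` over the particles. -/
noncomputable def pairing (p : ℝ) (ξ : Config N k) (g : Fin N → ℝ) : ℝ := ∑ y, weight p ξ y * g y

theorem count_bondRight (ξ : Config N k) (j : Fin (N - 1)) :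
    count ξ (bondRight j).val
      = count ξ (bondLeft j).val + if ξ.1 (bondLeft j) = true then 1 else 0 :=
  count_succ ξ (bondLeft j)

theorem weight_flip_of_ne (p : ℝ) (ξ : Config N k) {j : Fin (N - 1)} {y : Fin N}
    (h1 : y ≠ bondLeft j) (h2 : y ≠ bondRight j) : weight p (flip ξ j) y = weight p ξ y := by
  unfold weight
  rw [flip_apply, Equiv.swap_apply_of_ne_of_ne h1 h2, count_flip]
  intro h
  exact h2 (Fin.ext h)

theorem count_flip_bondLeft (ξ : Config N k) (j : Fin (N - 1)) :
    count (flip ξ j) (bondLeft j).val = count ξ (bondLeft j).val :=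
  count_flip ξ j (by simp [bondLeft])

/-- A jumping particle keeps its weight, since it passes no other particle, and no other particle
sees its left count change. So a jump just transports one weight across the bond. -/
theorem pairing_flip_of_left (p : ℝ) (ξ : Config N k) (j : Fin (N - 1)) (g : Fin N → ℝ)
    (hl : ξ.1 (bondLeft j) = true) (hr : ξ.1 (bondRight j) = false) :
    pairing p (flip ξ j) g
      = pairing p ξ g + weight p ξ (bondLeft j) * (g (bondRight j) - g (bondLeft j)) := by
  have key : ∀ y, weight p (flip ξ j) y = weight p ξ y
      + ((if y = bondRight j then weight p ξ (bondLeft j) else 0)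
        - (if y = bondLeft j then weight p ξ (bondLeft j) else 0)) := by
    intro y
    rcases eq_or_ne y (bondLeft j) with rfl | h1
    · simp [weight, flip_apply, hr, bondLeft_ne_bondRight, hl]
    rcases eq_or_ne y (bondRight j) with rfl | h2
    · simp [weight, flip_apply, hr, (bondLeft_ne_bondRight j).symm, hl, count_bondRight,
        count_flip_bondLeft]
    rw [weight_flip_of_ne p ξ h1 h2]
    simp [h1, h2]
  unfold pairing
  simp only [key, add_mul, sub_mul, ite_mul, zero_mul, Finset.sum_add_distrib,
    Finset.sum_sub_distrib, Finset.sum_ite_eq', Finset.mem_univ, if_true]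
  ring

theorem pairing_flip_of_right (p : ℝ) (ξ : Config N k) (j : Fin (N - 1)) (g : Fin N → ℝ)
    (hl : ξ.1 (bondLeft j) = false) (hr : ξ.1 (bondRight j) = true) :
    pairing p (flip ξ j) g
      = pairing p ξ g + weight p ξ (bondRight j) * (g (bondLeft j) - g (bondRight j)) := by
  have key : ∀ y, weight p (flip ξ j) y = weight p ξ y
      + ((if y = bondLeft j then weight p ξ (bondRight j) else 0)
        - (if y = bondRight j then weight p ξ (bondRight j) else 0)) := by
    intro y
    rcases eq_or_ne y (bondLeft j) with rfl | h1
    · simp [weight, flip_apply, hr, bondLeft_ne_bondRight, hl, count_bondRight,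
        count_flip_bondLeft]
    rcases eq_or_ne y (bondRight j) with rfl | h2
    · simp [weight, flip_apply, hr, (bondLeft_ne_bondRight j).symm, hl]
    rw [weight_flip_of_ne p ξ h1 h2]
    simp [h1, h2]
  unfold pairing
  simp only [key, add_mul, sub_mul, ite_mul, zero_mul, Finset.sum_add_distrib,
    Finset.sum_sub_distrib, Finset.sum_ite_eq', Finset.mem_univ, if_true]
  ring

theorem weight_nonneg {p : ℝ} (hl : 1 < lam p) (ξ : Config N k) (y : Fin N) :
    0 ≤ weight p ξ y := by
  have : 0 < lam p := by linarith
  unfold weight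
  split_ifs <;> positivity

theorem weight_le {p : ℝ} (hl : 1 < lam p) (ξ : Config N k) (y : Fin N) :
    weight p ξ y ≤ lam p ^ k := by
  have : 0 < lam p := by linarith
  unfold weight
  split_ifs
  · exact pow_le_pow_right₀ hl.le (count_le ξ _)
  · positivity

/-- The generator of the random walk on the segment which jumps to the right at rate `p` and to
the left at rate `1 - p`. -/
noncomputable def walkLin (N : ℕ) (p : ℝ) : (Fin N → ℝ) →ₗ[ℝ] (Fin N → ℝ) where
  toFun g y := ∑ j : Fin (N - 1),
    ((if y = bondLeft j then p * (g (bondRight j) - g (bondLeft j)) else 0)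
      + (if y = bondRight j then (1 - p) * (g (bondLeft j) - g (bondRight j)) else 0))
  map_add' f g := by
    funext y
    simp only [Pi.add_apply, ← Finset.sum_add_distrib]
    refine Finset.sum_congr rfl fun j _ => ?_
    split_ifs <;> ring
  map_smul' r f := by
    funext y
    simp only [Pi.smul_apply, smul_eq_mul, RingHom.id_apply, Finset.mul_sum]
    refine Finset.sum_congr rfl fun j _ => ?_
    split_ifs <;> ring

/-- The generator of the random walk, as a bounded operator. -/
noncomputable def walk (N : ℕ) (p : ℝ) : (Fin N → ℝ) →L[ℝ] (Fin N → ℝ) :=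
  LinearMap.toContinuousLinearMap (walkLin N p)

theorem walk_apply (p : ℝ) (g : Fin N → ℝ) (y : Fin N) : walk N p g y = ∑ j : Fin (N - 1),
    ((if y = bondLeft j then p * (g (bondRight j) - g (bondLeft j)) else 0)
      + (if y = bondRight j then (1 - p) * (g (bondLeft j) - g (bondRight j)) else 0)) := rfl

theorem generator_apply (p : ℝ) (f : Config N k → ℝ) (ξ : Config N k) :
    generator N k p f ξ = ∑ j : Fin (N - 1), rate p ξ j * (f (flip ξ j) - f ξ) := rfl

theorem rate_nonneg {p : ℝ} (hp : 0 ≤ p) (hp1 : p ≤ 1) (ξ : Config N k) (j : Fin (N - 1)) :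
    0 ≤ rate p ξ j := by
  unfold rate
  split_ifs <;> linarith

theorem rate_le {p : ℝ} (hp : 0 ≤ p) (hp1 : p ≤ 1) (ξ : Config N k) (j : Fin (N - 1)) :
    rate p ξ j ≤ 1 := by
  unfold rate
  split_ifs with h1 h2
  · exact absurd h1 h2.asymm
  all_goals linarith

theorem generator_add_nonneg {p : ℝ} (hp : 0 ≤ p) (hp1 : p ≤ 1) (f : Config N k → ℝ)
    (hf : 0 ≤ f) : 0 ≤ generator N k p f + (N : ℝ) • f := by
  intro ξ
  rw [Pi.add_apply, Pi.smul_apply, generator_apply, smul_eq_mul, Pi.zero_apply]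
  have hfξ : 0 ≤ f ξ := hf ξ
  have : ∑ j : Fin (N - 1), rate p ξ j * (f (flip ξ j) - f ξ) ≥ ∑ j : Fin (N - 1), - f ξ := by
    refine Finset.sum_le_sum fun j _ => ?_
    have h1 := mul_nonneg (rate_nonneg hp hp1 ξ j) (hf (flip ξ j))
    have h2 := mul_le_mul_of_nonneg_right (rate_le hp hp1 ξ j) hfξ
    nlinarith
  simp only [Finset.sum_const, Finset.card_univ, Fintype.card_fin, nsmul_eq_mul] at this
  have h3 : ((N - 1 : ℕ) : ℝ) ≤ N := by exact_mod_cast Nat.sub_le N 1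
  have h4 := mul_le_mul_of_nonneg_right h3 hfξ
  linarith

theorem walk_add_nonneg {p : ℝ} (hp : 0 ≤ p) (hp1 : p ≤ 1) (f : Fin N → ℝ)
    (hf : 0 ≤ f) : 0 ≤ walk N p f + (2 * N : ℝ) • f := by
  intro y
  rw [Pi.add_apply, Pi.smul_apply, walk_apply, smul_eq_mul, Pi.zero_apply]
  have hfy : 0 ≤ f y := hf y
  have : ∑ j : Fin (N - 1),
    ((if y = bondLeft j then p * (f (bondRight j) - f (bondLeft j)) else 0)
      + (if y = bondRight j then (1 - p) * (f (bondLeft j) - f (bondRight j)) else 0))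
      ≥ ∑ j : Fin (N - 1), (-2 * f y) := by
    refine Finset.sum_le_sum fun j _ => ?_
    have h1 : -f y ≤ if y = bondLeft j then p * (f (bondRight j) - f (bondLeft j)) else 0 := by
      split_ifs with h
      · subst h
        have := mul_nonneg hp (hf (bondRight j))
        nlinarith
      · linarith
    have h2 : -f y ≤ if y = bondRight j then (1 - p) * (f (bondLeft j) - f (bondRight j))
        else 0 := by
      split_ifs with h
      · subst h
        have := mul_nonneg (sub_nonneg.2 hp1) (hf (bondLeft j))
        nlinarith
      · linarith
    linarith
  simp only [Finset.sum_const, Finset.card_univ, Fintype.card_fin, nsmul_eq_mul] at this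
  have h3 : ((N - 1 : ℕ) : ℝ) ≤ N := by exact_mod_cast Nat.sub_le N 1
  have h4 := mul_le_mul_of_nonneg_right h3 hfy
  linarith

theorem walk_const (p c : ℝ) : walk N p (fun _ => c) = 0 := by
  funext y
  simp [walk_apply]

end Weights

/-! ### Domination of exponential moments by independent walks -/

section ExponentialMoment

variable {N k : ℕ}

/-- Convexity of exp between 0 and c x. It replaces configuration-dependent weights by the common
bound c, making the estimate linear in the weight. -/
theorem exp_mul_sub_one_le {w c x : ℝ} (hw : 0 ≤ w) (hwc : w ≤ c) (hc : 0 < c) :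
    Real.exp (w * x) - 1 ≤ w * (c⁻¹ * (Real.exp (c * x) - 1)) := by
  have h := convexOn_exp.2 (Set.mem_univ (c * x)) (Set.mem_univ 0) (show 0 ≤ w / c by positivity)
    (show 0 ≤ 1 - w / c by rw [sub_nonneg, div_le_one hc]; exact hwc) (by ring)
  simp only [smul_eq_mul, mul_zero, add_zero, Real.exp_zero, mul_one] at h
  have e : w / c * (c * x) = w * x := by field_simp
  rw [e] at h
  calc _ ≤ w / c * Real.exp (c * x) + (1 - w / c) - 1 := by linarith
    _ = _ := by field_simp; ring

/-- Contribution of one bond to the generator of the exclusion process applied to an exponential,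
compared with the one of independent walks. -/
theorem rate_mul_exp_sub_one_le {p : ℝ} (hp : 1 / 2 < p) (hp1 : p < 1) (ξ : Config N k)
    (j : Fin (N - 1)) (g : Fin N → ℝ) {c : ℝ} (hc : lam p ^ k ≤ c) :
    rate p ξ j * (Real.exp (pairing p (flip ξ j) g - pairing p ξ g) - 1)
      ≤ weight p ξ (bondLeft j)
          * (p * (c⁻¹ * (Real.exp (c * (g (bondRight j) - g (bondLeft j))) - 1)))
        + weight p ξ (bondRight j)
          * ((1 - p) * (c⁻¹ * (Real.exp (c * (g (bondLeft j) - g (bondRight j))) - 1))) := by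
  have hl := one_lt_lam hp hp1
  have hl0 : 0 < lam p := by linarith
  have hc0 : 0 < c := lt_of_lt_of_le (by positivity) hc
  have hw := weight_nonneg hl ξ
  have hwc := fun y => (weight_le hl ξ y).trans hc
  rcases Bool.eq_false_or_eq_true (ξ.1 (bondLeft j)) with h1 | h1 <;>
    rcases Bool.eq_false_or_eq_true (ξ.1 (bondRight j)) with h2 | h2
  -- Both sites occupied: exclusion forbids the jump but the walks still exchange. The right weight
  -- is λ times the left one, so the first-order terms cancel and e^u + e^(-u) - 2 ≥ 0 remains.
  · have e : weight p ξ (bondRight j) * (1 - p) = weight p ξ (bondLeft j) * p := by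
      simp only [weight, h1, h2, if_true, count_bondRight, pow_succ]
      have : lam p * (1 - p) = p := by
        unfold lam; rw [div_mul_cancel₀]; linarith
      rw [mul_assoc, this]
    have hr : rate p ξ j = 0 := by simp [rate, h1, h2]
    rw [hr, zero_mul, ← mul_assoc (weight p ξ (bondLeft j)),
      ← mul_assoc (weight p ξ (bondRight j)), e, ← mul_add, ← mul_add]
    refine mul_nonneg (mul_nonneg (hw _) (by linarith)) (mul_nonneg (by positivity) ?_)
    have a1 := Real.add_one_le_exp (c * (g (bondRight j) - g (bondLeft j)))
    have a2 := Real.add_one_le_exp (c * (g (bondLeft j) - g (bondRight j)))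
    linarith
  · have hr : rate p ξ j = p := by simp [rate, h1, h2]
    have h0 : weight p ξ (bondRight j) = 0 := by simp [weight, h2]
    rw [hr, h0, pairing_flip_of_left p ξ j g h1 h2, add_sub_cancel_left, zero_mul, add_zero]
    have := mul_le_mul_of_nonneg_left (exp_mul_sub_one_le (x := g (bondRight j) - g (bondLeft j))
      (hw (bondLeft j)) (hwc _) hc0) (show 0 ≤ p by linarith)
    linarith
  · have hr : rate p ξ j = 1 - p := by simp [rate, h1, h2]
    have h0 : weight p ξ (bondLeft j) = 0 := by simp [weight, h1]
    rw [hr, h0, pairing_flip_of_right p ξ j g h1 h2, add_sub_cancel_left, zero_mul, zero_add]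
    have := mul_le_mul_of_nonneg_left (exp_mul_sub_one_le (x := g (bondLeft j) - g (bondRight j))
      (hw (bondRight j)) (hwc _) hc0) (show 0 ≤ 1 - p by linarith)
    linarith
  · simp [rate, weight, h1, h2]

theorem pairing_walk_div (p : ℝ) (ξ : Config N k) (E : Fin N → ℝ) :
    ∑ y, weight p ξ y * (walk N p E y / E y) = ∑ j : Fin (N - 1),
      (weight p ξ (bondLeft j) * (p * ((E (bondRight j) - E (bondLeft j)) / E (bondLeft j)))
        + weight p ξ (bondRight j)
          * ((1 - p) * ((E (bondLeft j) - E (bondRight j)) / E (bondRight j)))) := by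
  simp only [walk_apply, Finset.sum_div, Finset.mul_sum]
  rw [Finset.sum_comm]
  refine Finset.sum_congr rfl fun j _ => ?_
  simp only [add_div, mul_add, ite_div, zero_div, mul_ite, mul_zero, Finset.sum_add_distrib,
    Finset.sum_ite_eq', Finset.mem_univ, if_true, mul_div_assoc]

/-- The choice c⁻¹ log E turns e^(c(g(a) - g(b))) - 1 into (E(a) - E(b))/E(b), so the sum of the
bond estimates is exactly the walk generator applied to E, divided by E. -/
theorem generator_exp_pairing_le {p : ℝ} (hp : 1 / 2 < p) (hp1 : p < 1) (ξ : Config N k)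
    {E : Fin N → ℝ} (hE : ∀ y, 0 < E y) {c : ℝ} (hc : lam p ^ k ≤ c) :
    generator N k p (fun ζ => Real.exp (pairing p ζ fun y => c⁻¹ * Real.log (E y))) ξ
      ≤ Real.exp (pairing p ξ fun y => c⁻¹ * Real.log (E y))
        * ∑ y, weight p ξ y * (c⁻¹ * (walk N p E y / E y)) := by
  have hl := one_lt_lam hp hp1
  have hc0 : 0 < c := lt_of_lt_of_le (by positivity) hc
  have e : ∑ y, weight p ξ y * (c⁻¹ * (walk N p E y / E y))
      = c⁻¹ * ∑ y, weight p ξ y * (walk N p E y / E y) := by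
    rw [Finset.mul_sum]
    exact Finset.sum_congr rfl fun y _ => by ring
  rw [e, pairing_walk_div, generator_apply, Finset.mul_sum, Finset.mul_sum]
  refine Finset.sum_le_sum fun j _ => ?_
  set g : Fin N → ℝ := fun y => c⁻¹ * Real.log (E y) with hg
  have h := mul_le_mul_of_nonneg_left (rate_mul_exp_sub_one_le hp hp1 ξ j g hc)
    (Real.exp_pos (pairing p ξ g)).le
  have hx : ∀ a b, Real.exp (c * (g a - g b)) - 1 = (E a - E b) / E b := by
    intro a b
    simp only [hg]
    rw [← mul_sub, mul_inv_cancel_left₀ hc0.ne', Real.exp_sub, Real.exp_log (hE a),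
      Real.exp_log (hE b), sub_div, div_self (hE b).ne']
  rw [hx, hx, Real.exp_sub] at h
  have hne := (Real.exp_pos (pairing p ξ g)).ne'
  calc _ = Real.exp (pairing p ξ g) * (rate p ξ j *
        (Real.exp (pairing p (flip ξ j) g) / Real.exp (pairing p ξ g) - 1)) := by
        field_simp
    _ ≤ _ := h
    _ = _ := by ring

/-- Let E evolve backwards under the walk: the time derivative then cancels the bound of
`generator_exp_pairing_le`, which gives a supersolution. The lower bound δ keeps the logarithm
defined, since the walk preserves constants. -/
theorem semigroup_exp_pairing_le {p : ℝ} (hp : 1 / 2 < p) (hp1 : p < 1) {t : ℝ} (ht : 0 ≤ t)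
    (ξ : Config N k) {E : Fin N → ℝ} {δ : ℝ} (hδ : 0 < δ) (hE : ∀ y, δ ≤ E y)
    {c : ℝ} (hc : lam p ^ k ≤ c) :
    semigroup N k p t (fun ζ => Real.exp (pairing p ζ fun y => c⁻¹ * Real.log (E y))) ξ
      ≤ Real.exp (pairing p ξ fun y =>
          c⁻¹ * Real.log (NormedSpace.exp (t • walk N p) E y)) := by
  have hp0 : 0 ≤ p := by linarith
  set Q : ℝ → Fin N → ℝ := fun s => NormedSpace.exp ((t - s) • walk N p) E with hQ
  have hQpos : ∀ s ∈ Set.Icc 0 t, ∀ y, 0 < Q s y := by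
    intro s hs y
    have hts : 0 ≤ t - s := by linarith [hs.2]
    have h1 : (fun _ => δ) ≤ E := hE
    have h2 := exp_smul_mono (walk_add_nonneg hp0 hp1.le) hts h1 y
    rw [exp_smul_apply_eq_of_eq_zero (walk_const p δ)] at h2
    exact lt_of_lt_of_le hδ h2
  have hQd : ∀ s y, HasDerivAt (fun s => Q s y) (-walk N p (Q s) y) s := by
    intro s y
    have h1 := (hasDerivAt_exp_smul_apply (walk N p) E (t - s)).scomp s
      ((hasDerivAt_id s).const_sub t)
    have h2 := hasDerivAt_pi.1 h1 y
    simpa [Function.comp_def] using! h2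
  have key := exp_smul_apply_le_of_supersolution (A := generator N k p)
    (generator_add_nonneg hp0 hp1.le) ht
    (F := fun s ζ => Real.exp (pairing p ζ fun y => c⁻¹ * Real.log (Q s y)))
    (F' := fun s ζ => Real.exp (pairing p ζ fun y => c⁻¹ * Real.log (Q s y))
        * ∑ y, weight p ζ y * (c⁻¹ * (-walk N p (Q s) y / Q s y)))
    (fun s hs => by
      rw [hasDerivAt_pi]
      intro ζ
      refine HasDerivAt.exp ?_
      unfold pairing
      refine HasDerivAt.fun_sum fun y _ => ?_
      exact (((hQd s y).log (hQpos s hs y).ne').const_mul _).const_mul _)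
    (fun s hs => by
      intro ζ
      have := generator_exp_pairing_le hp hp1 ζ (hQpos s hs) hc
      simp only [Pi.add_apply, Pi.zero_apply, neg_div, mul_neg, Finset.sum_neg_distrib]
      linarith)
  have h := key ξ
  simpa [hQ, semigroup] using h

/-- Exponential moments of the weighted number of particles among the first sites. -/
theorem semigroup_exp_pairing_indicator_le {p : ℝ} (hp : 1 / 2 < p) (hp1 : p < 1) {t : ℝ}
    (ht : 0 ≤ t) (ξ : Config N k) {g : Fin N → ℝ} (hg : ∀ y, g y = 0 ∨ g y = 1) (s : ℝ) :
    semigroup N k p t (fun ζ => Real.exp (s * pairing p ζ g)) ξ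
      ≤ Real.exp ((lam p ^ k)⁻¹ * (Real.exp (lam p ^ k * s) - 1)
          * pairing p ξ (NormedSpace.exp (t • walk N p) g)) := by
  have hp0 : 0 ≤ p := by linarith
  have hl := one_lt_lam hp hp1
  set c := lam p ^ k with hc
  have hc0 : 0 < c := by positivity
  set a := Real.exp (c * s) - 1 with ha
  -- As g takes only the values 0 and 1, this affine function equals e^(c s g), so c⁻¹ log E = s g.
  -- Being affine in g, it evolves explicitly under the walk, and log(1 + u) ≤ u then yields a
  -- Poisson bound.
  set E : Fin N → ℝ := (fun _ => 1) + a • g with hE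
  have hEval : ∀ y, E y = Real.exp (c * s * g y) := by
    intro y
    rcases hg y with h | h <;> simp [hE, ha, h]
  have hEmin : ∀ y, min 1 (Real.exp (c * s)) ≤ E y := by
    intro y
    rw [hEval]
    rcases hg y with h | h <;> simp [h]
  have h := semigroup_exp_pairing_le hp hp1 ht ξ
    (lt_min one_pos (Real.exp_pos (c * s))) hEmin hc.symm.le
  have e1 : ∀ ζ : Config N k, (pairing p ζ fun y => c⁻¹ * Real.log (E y)) = s * pairing p ζ g := by
    intro ζ
    unfold pairing
    rw [Finset.mul_sum]
    refine Finset.sum_congr rfl fun y _ => ?_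
    simp only [hEval, Real.log_exp]
    field_simp
  simp only [e1] at h
  refine h.trans (Real.exp_le_exp.2 ?_)
  unfold pairing
  rw [Finset.mul_sum]
  refine Finset.sum_le_sum fun y _ => ?_
  have e2 : NormedSpace.exp (t • walk N p) E y = 1 + a * NormedSpace.exp (t • walk N p) g y := by
    rw [hE, map_add, map_smul, exp_smul_apply_eq_of_eq_zero (walk_const p 1)]
    rfl
  have hpos : 0 < NormedSpace.exp (t • walk N p) E y := by
    have h1 : (fun _ => min 1 (Real.exp (c * s))) ≤ E := hEmin
    have h2 := exp_smul_mono (walk_add_nonneg hp0 hp1.le) ht h1 y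
    rw [exp_smul_apply_eq_of_eq_zero (walk_const p _)] at h2
    exact lt_of_lt_of_le (lt_min one_pos (Real.exp_pos (c * s))) h2
  have h3 := Real.log_le_sub_one_of_pos hpos
  rw [e2] at h3
  simp only [e2]
  have h4 := mul_le_mul_of_nonneg_left h3
    (mul_nonneg (weight_nonneg hl ξ y) (inv_pos.2 hc0).le)
  calc _ = weight p ξ y * c⁻¹ * Real.log (1 + a * NormedSpace.exp (t • walk N p) g y) := by ring
    _ ≤ _ := h4
    _ = _ := by ring

end ExponentialMoment

/-! ### Relaxation of the mean -/

section Mean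

variable {N k : ℕ}

/-- The indicator of the first `x` sites. -/
noncomputable def firstSites (N x : ℕ) : Fin N → ℝ := fun y => if y.val < x then 1 else 0

/-- The mass that the invariant law of the random walk gives to the first `x` sites. -/
noncomputable def invMass (N : ℕ) (p : ℝ) (x : ℕ) : ℝ := (lam p ^ x - 1) / (lam p ^ N - 1)

theorem firstSites_zero : firstSites N 0 = 0 := by
  funext y; simp [firstSites]

theorem firstSites_self : firstSites N N = fun _ => 1 := by
  funext y; simp [firstSites]

theorem firstSites_eq_zero_or_one (x : ℕ) (y : Fin N) :
    firstSites N x y = 0 ∨ firstSites N x y = 1 := by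
  unfold firstSites; split_ifs <;> simp

/-- Only one bond crosses the edge of the initial segment. The outcome is again a combination of
such indicators, which closes the mean evolution into an equation in x with the jump rates reversed.
-/
theorem walk_firstSites (p : ℝ) {x : ℕ} (hx : 0 < x) (hxN : x < N) :
    walk N p (firstSites N x) = p • (firstSites N (x - 1) - firstSites N x)
      + (1 - p) • (firstSites N (x + 1) - firstSites N x) := by
  funext y
  have hj : x - 1 < N - 1 := by omega
  have key : ∀ j : Fin (N - 1),
      ((if y = bondLeft j then
          p * (firstSites N x (bondRight j) - firstSites N x (bondLeft j)) else 0)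
        + (if y = bondRight j then
          (1 - p) * (firstSites N x (bondLeft j) - firstSites N x (bondRight j)) else 0))
      = if j = ⟨x - 1, hj⟩ then
          ((if y.val = x - 1 then -p else 0) + (if y.val = x then 1 - p else 0)) else 0 := by
    intro j
    have h1 : firstSites N x (bondRight j) - firstSites N x (bondLeft j)
        = if j.val = x - 1 then -1 else 0 := by
      have hl : (bondLeft j).val = j.val := rfl
      have hr : (bondRight j).val = j.val + 1 := rfl
      unfold firstSites
      rcases lt_trichotomy j.val (x - 1) with h | h | h
      · rw [if_pos (by omega), if_pos (by omega), if_neg (by omega), sub_self]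
      · rw [if_neg (by omega), if_pos (by omega), if_pos h, zero_sub]
      · rw [if_neg (by omega), if_neg (by omega), if_neg (by omega), sub_self]
    rw [← neg_sub (firstSites N x (bondRight j)), h1]
    simp only [Fin.ext_iff, bondLeft, bondRight]
    split_ifs <;> first | omega | norm_num
  rw [walk_apply, Finset.sum_congr rfl fun j _ => key j, Finset.sum_ite_eq']
  simp only [Finset.mem_univ, if_true, Pi.add_apply, Pi.smul_apply, Pi.sub_apply, smul_eq_mul,
    firstSites]
  split_ifs <;> first | omega | norm_num

theorem pairing_add (p : ℝ) (ξ : Config N k) (f g : Fin N → ℝ) :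
    pairing p ξ (f + g) = pairing p ξ f + pairing p ξ g := by
  simp [pairing, mul_add, Finset.sum_add_distrib]

theorem pairing_smul (p : ℝ) (ξ : Config N k) (a : ℝ) (f : Fin N → ℝ) :
    pairing p ξ (a • f) = a * pairing p ξ f := by
  simp only [pairing, Pi.smul_apply, smul_eq_mul, Finset.mul_sum]
  exact Finset.sum_congr rfl fun y _ => by ring

theorem pairing_sub (p : ℝ) (ξ : Config N k) (f g : Fin N → ℝ) :
    pairing p ξ (f - g) = pairing p ξ f - pairing p ξ g := by
  simp [pairing, mul_sub, Finset.sum_sub_distrib]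

theorem pairing_mono {p : ℝ} (hl : 1 < lam p) (ξ : Config N k) {f g : Fin N → ℝ} (h : f ≤ g) :
    pairing p ξ f ≤ pairing p ξ g :=
  Finset.sum_le_sum fun y _ => mul_le_mul_of_nonneg_left (h y) (weight_nonneg hl ξ y)

theorem pairing_firstSites {p : ℝ} (hl : 1 < lam p) (ξ : Config N k) {x : ℕ} (hx : x ≤ N) :
    pairing p ξ (firstSites N x) = (lam p ^ count ξ x - 1) / (lam p - 1) := by
  have h1 : lam p - 1 ≠ 0 := by linarith
  induction x with
  | zero => simp [firstSites_zero, pairing, count_zero]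
  | succ x ih =>
    have hs : firstSites N (x + 1) = firstSites N x
        + fun y => if y = ⟨x, hx⟩ then 1 else 0 := by
      funext y
      simp only [firstSites, Pi.add_apply, Fin.ext_iff]
      split_ifs <;> first | omega | ring
    rw [hs, pairing_add, ih (by omega)]
    have hc := count_succ ξ ⟨x, hx⟩
    simp only at hc
    simp only [pairing, mul_ite, mul_one, mul_zero, Finset.sum_ite_eq', Finset.mem_univ, if_true]
    rw [hc]
    unfold weight
    split_ifs
    · rw [pow_succ]; field_simp; ring
    · simp

theorem pairing_one {p : ℝ} (hl : 1 < lam p) (ξ : Config N k) :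
    pairing p ξ (fun _ => 1) = (lam p ^ k - 1) / (lam p - 1) := by
  rw [← firstSites_self, pairing_firstSites hl ξ le_rfl, count_self]

theorem invMass_zero (p : ℝ) : invMass N p 0 = 0 := by simp [invMass]

theorem invMass_nonneg {p : ℝ} (hl : 1 < lam p) (x : ℕ) : 0 ≤ invMass N p x :=
  div_nonneg (sub_nonneg.2 (one_le_pow₀ hl.le)) (sub_nonneg.2 (one_le_pow₀ hl.le))

theorem invMass_self {p : ℝ} (hN : 1 ≤ N) (hl : 1 < lam p) : invMass N p N = 1 :=
  div_self (sub_ne_zero.2 (one_lt_pow₀ hl (by omega)).ne')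

theorem invMass_mono {p : ℝ} (hl : 1 < lam p) {x y : ℕ} (h : x ≤ y) :
    invMass N p x ≤ invMass N p y :=
  div_le_div_of_nonneg_right (sub_le_sub_right (pow_le_pow_right₀ hl.le h) 1)
    (sub_nonneg.2 (one_le_pow₀ hl.le))

theorem lam_mul {p : ℝ} (hp1 : p < 1) : lam p * (1 - p) = p := by
  unfold lam
  rw [div_mul_cancel₀]
  linarith

/-- Stationarity for the equation in x: subtracting the equilibrium value leaves a solution with
zero boundary values. -/
theorem invMass_harmonic {p : ℝ} (hp1 : p < 1) {x : ℕ} (hx : 0 < x) :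
    p * (invMass N p (x - 1) - invMass N p x) + (1 - p) * (invMass N p (x + 1) - invMass N p x)
      = 0 := by
  obtain ⟨y, rfl⟩ : ∃ y, x = y + 1 := ⟨x - 1, by omega⟩
  have h := lam_mul hp1
  simp only [invMass, Nat.add_sub_cancel]
  generalize lam p = l at *
  rw [div_sub_div_same, div_sub_div_same, ← mul_div_assoc, ← mul_div_assoc, ← add_div]
  convert zero_div _ using 2
  linear_combination (l ^ y * (l - 1)) * h

/-- The Dirichlet operator of the walk whose jumps are reversed, on the edges of the segment. -/
noncomputable def dirichletLin (N : ℕ) (p : ℝ) :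
    (Fin (N + 1) → ℝ) →ₗ[ℝ] (Fin (N + 1) → ℝ) where
  toFun f x := (if h : 0 < x.val ∧ x.val < N then
    p * f ⟨x.val - 1, by omega⟩ + (1 - p) * f ⟨x.val + 1, by omega⟩ else 0) - f x
  map_add' f g := by
    funext x
    simp only [Pi.add_apply]
    split_ifs <;> ring
  map_smul' r f := by
    funext x
    simp only [Pi.smul_apply, smul_eq_mul, RingHom.id_apply]
    split_ifs <;> ring

/-- The Dirichlet operator, as a bounded operator. -/
noncomputable def dirichlet (N : ℕ) (p : ℝ) : (Fin (N + 1) → ℝ) →L[ℝ] (Fin (N + 1) → ℝ) :=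
  LinearMap.toContinuousLinearMap (dirichletLin N p)

theorem dirichlet_apply (p : ℝ) (f : Fin (N + 1) → ℝ) (x : Fin (N + 1)) :
    dirichlet N p f x = (if h : 0 < x.val ∧ x.val < N then
      p * f ⟨x.val - 1, by omega⟩ + (1 - p) * f ⟨x.val + 1, by omega⟩ else 0) - f x := rfl

theorem dirichlet_add_nonneg {p : ℝ} (hp : 0 ≤ p) (hp1 : p ≤ 1) (f : Fin (N + 1) → ℝ)
    (hf : 0 ≤ f) : 0 ≤ dirichlet N p f + (1 : ℝ) • f := by
  intro x
  simp only [Pi.add_apply, dirichlet_apply, one_smul, sub_add_cancel, Pi.zero_apply]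
  split_ifs
  · exact add_nonneg (mul_nonneg hp (hf _)) (mul_nonneg (by linarith) (hf _))
  · exact le_rfl

theorem sqrt_lam_mul {p : ℝ} (hp1 : p < 1) :
    (1 - p) * √(lam p) = √(p * (1 - p)) := by
  have hq : 0 < 1 - p := by linarith
  rw [show p * (1 - p) = (1 - p) ^ 2 * lam p by
    rw [sq, mul_assoc, mul_comm (1 - p) (lam p), lam_mul hp1]; ring,
    Real.sqrt_mul (by positivity), Real.sqrt_sq hq.le]

/-- The factor √λ^x symmetrizes the walk: both weighted rates become √(pq), and the cosine is an
eigenfunction of the resulting nearest-neighbour sum. At the two ends the operator is minus the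
identity, so nonnegativity of the cosines suffices; this is where α N ≤ π enters. -/
theorem dirichlet_supersolution {p : ℝ} (hp : 1 / 2 < p) (hp1 : p < 1) {α : ℝ}
    (hα : 0 ≤ α) (hαN : α * N ≤ Real.pi) (hN : 2 ≤ N) (x : Fin (N + 1)) :
    dirichlet N p (fun x => √(lam p) ^ x.val * Real.cos (α * (x.val - N / 2))) x
      ≤ -((1 - 2 * √(p * (1 - p)) * Real.cos α)
        * (√(lam p) ^ x.val * Real.cos (α * (x.val - N / 2)))) := by
  have hp0 : 0 ≤ p := by linarith
  have hl := one_lt_lam hp hp1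
  have hr : 0 < √(lam p) := Real.sqrt_pos.2 (by linarith)
  have hσ := sqrt_lam_mul hp1
  have hr2 : √(lam p) * √(lam p) = lam p := Real.mul_self_sqrt (by linarith)
  have hcos : 0 ≤ Real.cos α := by
    apply Real.cos_nonneg_of_neg_pi_div_two_le_of_le <;>
    · have : (2 : ℝ) ≤ N := by exact_mod_cast hN
      nlinarith [Real.pi_pos]
  rw [dirichlet_apply]
  split_ifs with h
  · obtain ⟨y, hy⟩ : ∃ y, x.val = y + 1 := ⟨x.val - 1, by omega⟩
    simp only [hy, Nat.add_sub_cancel]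
    have h1 : Real.cos (α * ((y : ℝ) - N / 2)) + Real.cos (α * (((y + 1 + 1 : ℕ) : ℝ) - N / 2))
        = 2 * Real.cos α * Real.cos (α * (((y + 1 : ℕ) : ℝ) - N / 2)) := by
      have e1 : α * ((y : ℝ) - N / 2) = α * (((y + 1 : ℕ) : ℝ) - N / 2) - α := by push_cast; ring
      have e2 : α * (((y + 1 + 1 : ℕ) : ℝ) - N / 2) = α * (((y + 1 : ℕ) : ℝ) - N / 2) + α := by
        push_cast; ring
      rw [e1, e2, Real.cos_sub, Real.cos_add]
      ring
    have h2 : p = √(lam p) * √(p * (1 - p)) := by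
      rw [← hσ, mul_left_comm, hr2, mul_comm, lam_mul hp1]
    generalize Real.cos (α * ((y : ℝ) - N / 2)) = c0 at *
    generalize Real.cos (α * (((y + 1 + 1 : ℕ) : ℝ) - N / 2)) = c2 at *
    generalize Real.cos (α * (((y + 1 : ℕ) : ℝ) - N / 2)) = c1 at *
    generalize √(p * (1 - p)) = σ at *
    have : p * (√(lam p) ^ y * c0) + (1 - p) * (√(lam p) ^ (y + 1 + 1) * c2)
        = √(lam p) ^ (y + 1) * σ * (c0 + c2) := by
      rw [show p * (√(lam p) ^ y * c0) = √(lam p) * σ * (√(lam p) ^ y * c0) by rw [← h2], ← hσ]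
      ring
    rw [this, h1]
    apply le_of_eq
    ring
  · have hpos : 0 ≤ √(lam p) ^ x.val * Real.cos (α * (x.val - N / 2)) := by
      refine mul_nonneg (by positivity) ?_
      have hx : (x.val : ℝ) ≤ N := by exact_mod_cast Nat.lt_succ_iff.1 x.isLt
      have hx0 : (0 : ℝ) ≤ x.val := by positivity
      apply Real.cos_nonneg_of_neg_pi_div_two_le_of_le <;> nlinarith
    have := mul_nonneg (mul_nonneg (Real.sqrt_nonneg (p * (1 - p))) hcos) hpos
    nlinarith

/-- Comparison with a decaying multiple of the tilted cosine. At α N = π the cosine vanishes at the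
ends and cannot dominate the initial data; the strict inequality leaves the finite prefactor 1/cos(α
N / 2). -/
theorem dirichlet_solution_le {p : ℝ} (hp : 1 / 2 < p) (hp1 : p < 1) {α : ℝ}
    (hα : 0 ≤ α) (hαN : α * N < Real.pi) (hN : 2 ≤ N) {b : ℝ → Fin (N + 1) → ℝ}
    (hb : ∀ s, HasDerivAt b (dirichlet N p (b s)) s) {K : ℝ} (hK : 0 ≤ K) (h0 : ∀ x, b 0 x ≤ K)
    {t : ℝ} (ht : 0 ≤ t) (x : Fin (N + 1)) :
    b t x ≤ K / Real.cos (α * N / 2) * lam p ^ N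
      * Real.exp (-(1 - 2 * √(p * (1 - p)) * Real.cos α) * t) := by
  have hp0 : 0 ≤ p := by linarith
  have hl := one_lt_lam hp hp1
  have hr1 : 1 ≤ √(lam p) := Real.one_le_sqrt.2 hl.le
  have hrl : √(lam p) ≤ lam p := by
    rw [Real.sqrt_le_left (by linarith)]; nlinarith
  have hc : 0 < Real.cos (α * N / 2) := by
    apply Real.cos_pos_of_mem_Ioo
    have : 0 ≤ α * N := by positivity
    constructor <;> linarith [Real.pi_pos]
  set γ := 1 - 2 * √(p * (1 - p)) * Real.cos α with hγ
  set φ : Fin (N + 1) → ℝ := fun x => √(lam p) ^ x.val * Real.cos (α * (x.val - N / 2)) with hφ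
  set C := K / Real.cos (α * N / 2) with hC
  have hC0 : 0 ≤ C := by positivity
  have hφ1 : ∀ x, Real.cos (α * N / 2) ≤ φ x := by
    intro x
    have hx : (x.val : ℝ) ≤ N := by exact_mod_cast Nat.lt_succ_iff.1 x.isLt
    have hx0 : (0 : ℝ) ≤ x.val := by positivity
    have h1 : Real.cos (α * N / 2) ≤ Real.cos (α * (x.val - N / 2)) := by
      rw [← Real.cos_abs (α * (x.val - N / 2))]
      apply Real.cos_le_cos_of_nonneg_of_le_pi (abs_nonneg _)
      · have : 0 ≤ α * N := by positivity
        linarith [Real.pi_pos]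
      · rw [abs_le]; constructor <;> nlinarith
    calc _ ≤ 1 * Real.cos (α * (x.val - N / 2)) := by linarith
      _ ≤ _ := mul_le_mul_of_nonneg_right (one_le_pow₀ hr1) (hc.le.trans h1)
  have hφ2 : ∀ x, φ x ≤ lam p ^ N := by
    intro x
    calc φ x ≤ √(lam p) ^ x.val * 1 :=
          mul_le_mul_of_nonneg_left (Real.cos_le_one _) (by positivity)
      _ ≤ √(lam p) ^ N := by
          rw [mul_one]; exact pow_le_pow_right₀ hr1 (Nat.lt_succ_iff.1 x.isLt)
      _ ≤ _ := pow_le_pow_left₀ (by linarith) hrl N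
  have key := nonpos_of_subsolution (A := dirichlet N p) (dirichlet_add_nonneg hp0 hp1.le) ht
    (b := fun s => b s - (C * Real.exp (-γ * s)) • φ)
    (b' := fun s => dirichlet N p (b s) - (C * (Real.exp (-γ * s) * -γ)) • φ)
    (fun s => by
      have h1 : HasDerivAt (fun s => C * Real.exp (-γ * s)) (C * (Real.exp (-γ * s) * -γ)) s := by
        have := ((hasDerivAt_id s).const_mul (-γ)).exp.const_mul C
        simpa using this
      exact (hb s).sub (h1.smul_const φ))
    (fun s _ => by
      rw [map_sub, map_smul]
      intro y
      have h1 := dirichlet_supersolution hp hp1 hα hαN.le hN y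
      have h2 : 0 ≤ C * Real.exp (-γ * s) := by positivity
      have h3 := mul_le_mul_of_nonneg_left h1 h2
      simp only [Pi.sub_apply, Pi.smul_apply, smul_eq_mul]
      change _ ≤ C * Real.exp (-γ * s) * -(γ * φ y) at h3
      have e : C * (Real.exp (-γ * s) * -γ) * φ y = C * Real.exp (-γ * s) * -(γ * φ y) := by ring
      linarith)
    (by
      intro y
      have h1 := hφ1 y
      have h2 : K ≤ C * φ y := by
        calc K = C * Real.cos (α * N / 2) := by rw [hC]; field_simp
          _ ≤ _ := mul_le_mul_of_nonneg_left h1 hC0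
      simp only [Pi.sub_apply, Pi.smul_apply, smul_eq_mul, mul_zero, Real.exp_zero, mul_one,
        Pi.zero_apply]
      linarith [h0 y])
  have h := key x
  simp only [Pi.sub_apply, Pi.smul_apply, smul_eq_mul, Pi.zero_apply] at h
  have h2 := mul_le_mul_of_nonneg_left (hφ2 x) (show 0 ≤ C * Real.exp (-γ * t) by positivity)
  calc b t x ≤ C * Real.exp (-γ * t) * φ x := by linarith
    _ ≤ _ := h2
    _ = _ := by ring

/-- Relaxation of the mean of the weighted number of particles among the first sites. -/
theorem abs_pairing_exp_walk_sub_le {p : ℝ} (hp : 1 / 2 < p) (hp1 : p < 1) {α : ℝ}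
    (hα : 0 ≤ α) (hαN : α * N < Real.pi) (hN : 2 ≤ N) (ξ : Config N k)
    {t : ℝ} (ht : 0 ≤ t) {x : ℕ} (hx : x ≤ N) :
    |pairing p ξ (NormedSpace.exp (t • walk N p) (firstSites N x))
        - pairing p ξ (fun _ => 1) * invMass N p x|
      ≤ pairing p ξ (fun _ => 1) / Real.cos (α * N / 2) * lam p ^ N
      * Real.exp (-(1 - 2 * √(p * (1 - p)) * Real.cos α) * t) := by
  have hp0 : 0 ≤ p := by linarith
  have hl := one_lt_lam hp hp1
  set m := pairing p ξ (fun _ => 1) with hm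
  have hm0 : 0 ≤ m := by
    refine Finset.sum_nonneg fun y _ => mul_nonneg (weight_nonneg hl ξ y) zero_le_one
  set b : ℝ → Fin (N + 1) → ℝ := fun s x =>
    pairing p ξ (NormedSpace.exp (s • walk N p) (firstSites N x.val)) - m * invMass N p x.val
    with hb
  have hbd : ∀ s, HasDerivAt b (dirichlet N p (b s)) s := by
    intro s
    rw [hasDerivAt_pi]
    intro y
    have hd : HasDerivAt (fun s => b s y)
        (pairing p ξ (NormedSpace.exp (s • walk N p) (walk N p (firstSites N y.val)))) s := by
      refine HasDerivAt.sub_const _ ?_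
      unfold pairing
      refine HasDerivAt.fun_sum fun z _ => ?_
      have h1 := (ContinuousLinearMap.apply ℝ (Fin N → ℝ)
        (firstSites N y.val)).hasFDerivAt.comp_hasDerivAt s
        (hasDerivAt_exp_smul_const (𝕂 := ℝ) (walk N p) s)
      exact (hasDerivAt_pi.1 h1 z).const_mul _
    rw [dirichlet_apply]
    split_ifs with h
    · refine hd.congr_deriv (Eq.symm ?_)
      have hh := invMass_harmonic (N := N) hp1 h.1
      simp only [hb, walk_firstSites p h.1 h.2, map_add, map_smul, map_sub, pairing_add,
        pairing_smul, pairing_sub]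
      linear_combination (-m) * hh
    -- At the ends the indicator is constant, hence fixed by the walk, and the deviation vanishes
    -- identically.
    · have hy : y.val = 0 ∨ y.val = N := by omega
      have hconst : walk N p (firstSites N y.val) = 0 := by
        rcases hy with hy | hy
        · rw [hy, firstSites_zero, map_zero]
        · rw [hy, firstSites_self, walk_const]
      have hb0 : b s y = 0 := by
        simp only [hb, exp_smul_apply_eq_of_eq_zero hconst s]
        rcases hy with hy | hy
        · simp [hy, firstSites_zero, invMass_zero, pairing]
        · rw [hy, firstSites_self, invMass_self (by omega) hl, ← hm]; ring
      rw [hconst, map_zero] at hd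
      rw [hb0, sub_zero]
      simpa [pairing] using hd
  have hrange : ∀ y : Fin (N + 1), 0 ≤ pairing p ξ (firstSites N y.val) ∧
      pairing p ξ (firstSites N y.val) ≤ m ∧ 0 ≤ m * invMass N p y.val ∧
      m * invMass N p y.val ≤ m := by
    intro y
    have hy : y.val ≤ N := Nat.lt_succ_iff.1 y.isLt
    have h1 := invMass_mono (N := N) hl hy
    rw [invMass_self (by omega) hl] at h1
    refine ⟨?_, ?_, mul_nonneg hm0 (invMass_nonneg hl _), by nlinarith⟩
    · refine Finset.sum_nonneg fun z _ => mul_nonneg (weight_nonneg hl ξ z) ?_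
      rcases firstSites_eq_zero_or_one y.val z with h | h <;> simp [h]
    · refine pairing_mono hl ξ fun z => ?_
      rcases firstSites_eq_zero_or_one y.val z with h | h <;> simp [h]
  have hb00 : ∀ y, b 0 y = pairing p ξ (firstSites N y.val) - m * invMass N p y.val := by
    intro y; simp [hb]
  have h1 := dirichlet_solution_le hp hp1 hα hαN hN hbd hm0
    (fun y => by rw [hb00]; obtain ⟨a1, a2, a3, a4⟩ := hrange y; linarith) ht ⟨x, by omega⟩
  have h2 := dirichlet_solution_le hp hp1 hα hαN hN (b := fun s => -b s)
    (fun s => by rw [map_neg]; exact (hbd s).neg) hm0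
    (fun y => by
      rw [Pi.neg_apply, hb00]; obtain ⟨a1, a2, a3, a4⟩ := hrange y; linarith) ht ⟨x, by omega⟩
  rw [Pi.neg_apply] at h2
  rw [abs_le]
  simp only [hb] at h1 h2
  constructor <;> linarith

theorem rho_eq {p : ℝ} (hp : 0 ≤ p) (hp1 : p ≤ 1) : rho p = 1 - 2 * √(p * (1 - p)) := by
  unfold rho
  rw [sub_sq, Real.sq_sqrt hp, Real.sq_sqrt (by linarith), Real.sqrt_mul hp]
  ring

/-- The right side is ϱ + 4√(pq) sin²(sπ/(2N)), which is the gap at s = 1; concavity of sine gives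
sin(sz) ≥ s sin z. Lowering the frequency thus costs only a factor s² in the rate. -/
theorem mul_gap_le {p : ℝ} (hp : 0 ≤ p) (hp1 : p ≤ 1) (hN : 1 ≤ N) {s : ℝ} (hs : 0 ≤ s)
    (hs1 : s ≤ 1) :
    s ^ 2 * gap N p ≤ 1 - 2 * √(p * (1 - p)) * Real.cos (s * Real.pi / N) := by
  have hN' : (1 : ℝ) ≤ N := by exact_mod_cast hN
  have hN0 : (0 : ℝ) < N := by linarith
  have hz : Real.pi / (2 * N) ≤ Real.pi := by
    apply div_le_self Real.pi_pos.le; linarith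
  have hz0 : 0 ≤ Real.pi / (2 * N) := by positivity
  have hsin0 := Real.sin_nonneg_of_nonneg_of_le_pi hz0 hz
  have h := strictConcaveOn_sin_Icc.concaveOn.2 (x := Real.pi / (2 * N)) ⟨hz0, hz⟩ (y := 0)
    ⟨le_rfl, Real.pi_pos.le⟩ hs (sub_nonneg.2 hs1) (by ring)
  simp only [smul_eq_mul, Real.sin_zero, mul_zero, add_zero] at h
  have hcos : Real.cos (s * Real.pi / N) = 1 - 2 * Real.sin (s * (Real.pi / (2 * N))) ^ 2 := by
    have e : s * Real.pi / N = 2 * (s * (Real.pi / (2 * N))) := by field_simp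
    rw [e, Real.cos_two_mul, Real.cos_sq']
    ring
  have hρ : 0 ≤ rho p := sq_nonneg _
  have hσ := Real.sqrt_nonneg (p * (1 - p))
  have h2 : (s * Real.sin (Real.pi / (2 * N))) ^ 2 ≤ Real.sin (s * (Real.pi / (2 * N))) ^ 2 :=
    pow_le_pow_left₀ (by positivity) h 2
  have h3 : s ^ 2 * rho p ≤ rho p := by
    have : s ^ 2 ≤ 1 := by nlinarith
    nlinarith
  rw [hcos]
  have hr := rho_eq hp hp1
  unfold gap
  nlinarith [mul_le_mul_of_nonneg_left h2 hσ]

end Mean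

/-! ### From exponential moments to the maximal deviation -/

section Deviation

variable {N k : ℕ}

/-- The deviation of the weighted number of particles among the first `x` sites from its
equilibrium value. -/
noncomputable def excess (p : ℝ) (ξ : Config N k) (x : ℕ) : ℝ :=
  pairing p ξ (firstSites N x) - pairing p ξ (fun _ => 1) * invMass N p x

theorem height_eq (ξ : Config N k) {x : ℕ} (hx : x ≤ N) :
    height ξ x = 2 * (count ξ x : ℤ) - x := by
  induction x with
  | zero => simp [height_zero, count_zero]
  | succ x ih =>
    have hc := count_succ ξ ⟨x, hx⟩
    simp only at hc
    rw [height_succ ξ x hx, ih (by omega), hc]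
    split_ifs <;> push_cast <;> ring

theorem dev_eq {p : ℝ} (hp : 1 / 2 < p) (hp1 : p < 1) (ξ : Config N k) {x : ℕ} (hx : x ≤ N)
    (hN : 1 ≤ N) :
    dev p ξ x = lam p ^ (((N : ℝ) - k) / 2) * ((√(lam p) ^ x)⁻¹ * excess p ξ x) := by
  have hl := one_lt_lam hp hp1
  have hl0 : 0 < lam p := by linarith
  have hr : 0 < √(lam p) := Real.sqrt_pos.2 hl0
  have hsq : √(lam p) * √(lam p) = lam p := Real.mul_self_sqrt hl0.le
  have hlN : lam p ^ N - 1 ≠ 0 := by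
    have := one_lt_pow₀ hl (by omega : N ≠ 0)
    linarith
  have hl1 : lam p - 1 ≠ 0 := by linarith
  have e1 : lam p ^ ((height ξ x : ℝ) / 2) = lam p ^ count ξ x * (√(lam p) ^ x)⁻¹ := by
    rw [height_eq ξ hx]
    push_cast
    rw [show (2 * (count ξ x : ℝ) - x) / 2 = (count ξ x : ℝ) - (1 / 2 : ℝ) * x by ring,
      Real.rpow_sub hl0, Real.rpow_natCast, Real.rpow_mul hl0.le, Real.rpow_natCast,
      ← Real.sqrt_eq_rpow, div_eq_mul_inv]
  -- The profile is the value of λ^(h/2) at which the weighted particle sum is at equilibrium, with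
  -- the same factor √λ^(-x) extracted.
  have e2 : profile N k p x
      = (√(lam p) ^ x)⁻¹ * (1 + (lam p ^ k - 1) * invMass N p x) := by
    have e3 : lam p ^ x = √(lam p) ^ x * √(lam p) ^ x := by rw [← mul_pow, hsq]
    unfold profile invMass
    rw [inv_pow, e3]
    have : √(lam p) ^ x ≠ 0 := by positivity
    field_simp
    ring
  unfold dev excess
  rw [e1, e2, pairing_one hl, pairing_firstSites hl ξ hx]
  field_simp
  ring

theorem abs_dev_le {p : ℝ} (hp : 1 / 2 < p) (hp1 : p < 1) (ξ : Config N k) {x : ℕ} (hx : x ≤ N)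
    (hN : 1 ≤ N) : |dev p ξ x| ≤ lam p ^ N * |excess p ξ x| := by
  have hl := one_lt_lam hp hp1
  have hl0 : 0 < lam p := by linarith
  have hr : 1 ≤ √(lam p) := Real.one_le_sqrt.2 hl.le
  rw [dev_eq hp hp1 ξ hx hN, abs_mul, abs_mul, abs_of_pos (Real.rpow_pos_of_pos hl0 _),
    abs_of_pos (by positivity : 0 < (√(lam p) ^ x)⁻¹)]
  have h1 : lam p ^ (((N : ℝ) - k) / 2) ≤ lam p ^ N := by
    rw [← Real.rpow_natCast]
    apply Real.rpow_le_rpow_of_exponent_le hl.le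
    have : (0 : ℝ) ≤ k := by positivity
    have : (0 : ℝ) ≤ N := by positivity
    linarith
  have h2 : (√(lam p) ^ x)⁻¹ * |excess p ξ x| ≤ |excess p ξ x| :=
    mul_le_of_le_one_left (abs_nonneg _) (inv_le_one_of_one_le₀ (one_le_pow₀ hr))
  exact mul_le_mul h1 h2 (by positivity) (by positivity)

theorem pow_sub_one_le {l : ℝ} (hl : 1 ≤ l) (n : ℕ) : l ^ n - 1 ≤ n * (l - 1) * l ^ n := by
  induction n with
  | zero => simp
  | succ n ih =>
    have h1 := mul_le_mul_of_nonneg_left ih (by linarith : 0 ≤ l)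
    have h2 : l - 1 ≤ (l - 1) * l ^ (n + 1) :=
      le_mul_of_one_le_right (by linarith) (one_le_pow₀ hl)
    push_cast
    calc l ^ (n + 1) - 1 = l * (l ^ n - 1) + (l - 1) := by ring
      _ ≤ l * (n * (l - 1) * l ^ n) + (l - 1) * l ^ (n + 1) := add_le_add h1 h2
      _ = _ := by ring

theorem pairing_one_nonneg {p : ℝ} (hl : 1 < lam p) (ξ : Config N k) :
    0 ≤ pairing p ξ (fun _ => 1) :=
  Finset.sum_nonneg fun y _ => mul_nonneg (weight_nonneg hl ξ y) zero_le_one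

theorem pairing_one_le {p : ℝ} (hl : 1 < lam p) (ξ : Config N k) (hk : k ≤ N) :
    pairing p ξ (fun _ => 1) ≤ k * lam p ^ N := by
  have h1 : 0 < lam p - 1 := by linarith
  rw [pairing_one hl, div_le_iff₀ h1]
  calc lam p ^ k - 1 ≤ k * (lam p - 1) * lam p ^ k := pow_sub_one_le hl.le k
    _ ≤ k * (lam p - 1) * lam p ^ N :=
      mul_le_mul_of_nonneg_left (pow_le_pow_right₀ hl.le hk) (by positivity)
    _ = _ := by ring

/-- Bernoulli's inequality bounds the denominator below by N(λ - 1): the invariant law is uniform up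
to a factor λ^N. -/
theorem invMass_sub_le {p : ℝ} (hl : 1 < lam p) {a b : ℕ} (hab : a ≤ b) (hb : b ≤ N)
    (hN : 1 ≤ N) : invMass N p b - invMass N p a ≤ lam p ^ N * (b - a : ℕ) / N := by
  have h1 : 0 < lam p - 1 := by linarith
  have hN' : (0 : ℝ) < N := by exact_mod_cast hN
  have h2 : N * (lam p - 1) ≤ lam p ^ N - 1 := by
    have := one_add_mul_le_pow (a := lam p - 1) (by linarith) N
    rw [add_sub_cancel] at this
    linarith
  have h3 : lam p ^ b - lam p ^ a ≤ (b - a : ℕ) * (lam p - 1) * lam p ^ N := by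
    calc lam p ^ b - lam p ^ a = lam p ^ a * (lam p ^ (b - a) - 1) := by
          rw [mul_sub, ← pow_add, Nat.add_sub_cancel' hab, mul_one]
      _ ≤ lam p ^ a * ((b - a : ℕ) * (lam p - 1) * lam p ^ (b - a)) :=
          mul_le_mul_of_nonneg_left (pow_sub_one_le hl.le _) (by positivity)
      _ = (b - a : ℕ) * (lam p - 1) * lam p ^ b := by
          rw [mul_left_comm, ← pow_add, Nat.add_sub_cancel' hab]
      _ ≤ _ := mul_le_mul_of_nonneg_left (pow_le_pow_right₀ hl.le hb) (by positivity)
  have h4 : 0 < N * (lam p - 1) := by positivity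
  unfold invMass
  rw [div_sub_div_same, sub_sub_sub_cancel_right]
  calc _ ≤ (b - a : ℕ) * (lam p - 1) * lam p ^ N / (N * (lam p - 1)) :=
        div_le_div₀ (by positivity) h3 h4 h2
    _ = _ := by field_simp

/-- Control of the excess on a grid of `k + 1` sites gives a control at all sites. -/
theorem abs_excess_le_of_grid {p : ℝ} (hl : 1 < lam p) (ξ : Config N k) (hk : 1 ≤ k) (hkN : k ≤ N)
    {R : ℝ} (h : ∀ i ≤ k, |excess p ξ (min (i * (N / k + 1)) N)| ≤ R) {x : ℕ} (hx : x ≤ N) :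
    |excess p ξ x| ≤ R + 2 * lam p ^ N * lam p ^ N := by
  -- About N/k sites per block, so that a block has bounded equilibrium mass up to powers of λ^N.
  -- The union bound then costs a factor of order k and not N, which no power of k need control.
  set l := N / k + 1 with hldef
  set m := pairing p ξ (fun _ => 1) with hm
  have hm0 : 0 ≤ m := pairing_one_nonneg hl ξ
  have hkR : (0 : ℝ) < k := by exact_mod_cast hk
  have hNR : (0 : ℝ) < N := by exact_mod_cast hk.trans hkN
  have hlpos : 0 < l := Nat.succ_pos _
  have hlk : N < l * k := by
    rw [hldef, mul_comm]; exact Nat.lt_mul_div_succ N (by omega)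
  have hl2 : (l : ℝ) ≤ 2 * N / k := by
    rw [hldef]
    push_cast
    have h1 : ((N / k : ℕ) : ℝ) ≤ N / k := Nat.cast_div_le
    have h2 : 1 ≤ (N : ℝ) / k := by rw [one_le_div hkR]; exact_mod_cast hkN
    calc _ ≤ (N : ℝ) / k + N / k := add_le_add h1 h2
      _ = _ := by ring
  set i := x / l with hi
  have hik : i < k := by
    rw [hi, Nat.div_lt_iff_lt_mul hlpos, mul_comm]; omega
  have hia : i * l ≤ x := Nat.div_mul_le_self x l
  have hib : x < (i + 1) * l := by
    rw [mul_comm]; exact Nat.lt_mul_div_succ x hlpos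
  set a := min (i * l) N with ha
  set b := min ((i + 1) * l) N with hb
  have hax : a ≤ x := by omega
  have hxb : x ≤ b := by omega
  have hab : b - a ≤ l := by
    have : (i + 1) * l = i * l + l := by ring
    omega
  have hmono : ∀ {u v : ℕ}, u ≤ v → pairing p ξ (firstSites N u) ≤ pairing p ξ (firstSites N v) := by
    intro u v huv
    refine pairing_mono hl ξ fun y => ?_
    unfold firstSites
    split_ifs <;> first | omega | norm_num
  have hblock : m * (invMass N p b - invMass N p a) ≤ 2 * lam p ^ N * lam p ^ N := by
    have h1 := invMass_sub_le hl (hax.trans hxb) (min_le_right _ _) (hk.trans hkN)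
      (p := p) (a := a) (b := b)
    have h2 : ((b - a : ℕ) : ℝ) ≤ 2 * N / k := le_trans (by exact_mod_cast hab) hl2
    have h3 : lam p ^ N * (b - a : ℕ) / N ≤ 2 * lam p ^ N / k := by
      calc _ ≤ lam p ^ N * (2 * N / k) / N := by
            apply div_le_div_of_nonneg_right _ hNR.le
            exact mul_le_mul_of_nonneg_left h2 (by positivity)
        _ = _ := by field_simp
    calc _ ≤ m * (2 * lam p ^ N / k) := mul_le_mul_of_nonneg_left (h1.trans h3) hm0
      _ ≤ k * lam p ^ N * (2 * lam p ^ N / k) :=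
          mul_le_mul_of_nonneg_right (pairing_one_le hl ξ hkN) (by positivity)
      _ = _ := by field_simp
  have h1 := abs_le.1 (h i hik.le)
  have h2 := abs_le.1 (h (i + 1) hik)
  have h3 := hmono hax
  have h4 := hmono hxb
  have h5 := mul_le_mul_of_nonneg_left (invMass_mono (N := N) hl hax) hm0
  have h6 := mul_le_mul_of_nonneg_left (invMass_mono (N := N) hl hxb) hm0
  -- The excess is a difference of two functions increasing in x, so between grid points it varies
  -- from the endpoint values by at most the equilibrium mass of the block.
  simp only [excess, ← hm] at h1 h2 ⊢
  rw [abs_le]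
  constructor <;> linarith [h1.1, h2.2]

theorem semigroup_mono {p : ℝ} (hp : 0 ≤ p) (hp1 : p ≤ 1) {t : ℝ} (ht : 0 ≤ t)
    {f g : Config N k → ℝ} (hfg : f ≤ g) : semigroup N k p t f ≤ semigroup N k p t g :=
  exp_smul_mono (generator_add_nonneg hp hp1) ht hfg

/-- Exponential moment of the excess, at distance `D` from equilibrium in mean. -/
theorem semigroup_exp_excess_le {p : ℝ} (hp : 1 / 2 < p) (hp1 : p < 1) {t : ℝ} (ht : 0 ≤ t)
    (ξ : Config N k) {x : ℕ} {D : ℝ}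
    (hD : |pairing p ξ (NormedSpace.exp (t • walk N p) (firstSites N x))
        - pairing p ξ (fun _ => 1) * invMass N p x| ≤ D) {s : ℝ} (hs : |lam p ^ k * s| ≤ 1) :
    semigroup N k p t (fun ζ => Real.exp (s * excess p ζ x)) ξ
      ≤ Real.exp (|s| * D + lam p ^ k * s ^ 2 * pairing p ξ (fun _ => 1)) := by
  have hl := one_lt_lam hp hp1
  have hp0 : 0 ≤ p := by linarith
  set c := lam p ^ k with hc
  have hc0 : 0 < c := by positivity
  set m := pairing p ξ (fun _ => 1) with hm
  have hmζ : ∀ ζ : Config N k, pairing p ζ (fun _ => 1) = m := by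
    intro ζ; rw [hm, pairing_one hl, pairing_one hl]
  set g := firstSites N x with hg
  set μ := pairing p ξ (NormedSpace.exp (t • walk N p) g) with hμ
  have hg0 : 0 ≤ g := fun y => by
    rcases firstSites_eq_zero_or_one x y with h | h <;> simp [hg, h]
  have hg1 : g ≤ fun _ => 1 := fun y => by
    rcases firstSites_eq_zero_or_one x y with h | h <;> simp [hg, h]
  have hμ0 : 0 ≤ μ := by
    refine Finset.sum_nonneg fun y _ => mul_nonneg (weight_nonneg hl ξ y) ?_
    exact exp_smul_nonneg (walk_add_nonneg hp0 hp1.le) ht hg0 y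
  have hμm : μ ≤ m := by
    refine pairing_mono hl ξ ?_
    have := exp_smul_mono (walk_add_nonneg hp0 hp1.le) ht hg1
    rwa [exp_smul_apply_eq_of_eq_zero (walk_const p 1)] at this
  -- The linear term combines with the centering into the mean error D; the quadratic term is the
  -- variance contribution.
  have hexp : c⁻¹ * (Real.exp (c * s) - 1) ≤ s + c * s ^ 2 := by
    have h1 := (abs_le.1 (Real.abs_exp_sub_one_sub_id_le hs)).2
    calc c⁻¹ * (Real.exp (c * s) - 1) ≤ c⁻¹ * (c * s + (c * s) ^ 2) :=
          mul_le_mul_of_nonneg_left (by linarith) (by positivity)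
      _ = _ := by field_simp
  have e : (fun ζ : Config N k => Real.exp (s * excess p ζ x))
      = Real.exp (-(s * (m * invMass N p x))) • fun ζ => Real.exp (s * pairing p ζ g) := by
    funext ζ
    simp only [excess, hmζ, Pi.smul_apply, smul_eq_mul, ← Real.exp_add]
    congr 1
    ring
  rw [e, map_smul, Pi.smul_apply, smul_eq_mul]
  have key := semigroup_exp_pairing_indicator_le hp hp1 ht ξ (firstSites_eq_zero_or_one x) s
  refine (mul_le_mul_of_nonneg_left key (Real.exp_pos _).le).trans ?_
  rw [← Real.exp_add, Real.exp_le_exp]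
  have h1 : c⁻¹ * (Real.exp (c * s) - 1) * μ ≤ (s + c * s ^ 2) * μ :=
    mul_le_mul_of_nonneg_right hexp hμ0
  have h2 : c * s ^ 2 * μ ≤ c * s ^ 2 * m := mul_le_mul_of_nonneg_left hμm (by positivity)
  have h3 : s * (μ - m * invMass N p x) ≤ |s| * D := by
    calc _ ≤ |s * (μ - m * invMass N p x)| := le_abs_self _
      _ = |s| * |μ - m * invMass N p x| := abs_mul _ _
      _ ≤ _ := mul_le_mul_of_nonneg_left hD (abs_nonneg s)
  linarith

theorem transProb_maxDev_le {p : ℝ} (hp : 1 / 2 < p) (hp1 : p < 1) {t : ℝ} (ht : 0 ≤ t)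
    (hk : 1 ≤ k) (hkN : k ≤ N) (hN : 2 ≤ N) (ξ : Config N k) {α : ℝ}
    (hα : 0 ≤ α) (hαN : α * N < Real.pi) {s : ℝ} (hs : 0 ≤ s) (hs1 : lam p ^ k * s ≤ 1)
    {R R' : ℝ} (hR : lam p ^ N * (R' + 2 * lam p ^ N * lam p ^ N) ≤ R) :
    transProb p t ξ {ζ | R < maxDev p ζ} ≤ (k + 1) * (2 * Real.exp (s * (k * lam p ^ N
        / Real.cos (α * N / 2) * lam p ^ N
        * Real.exp (-(1 - 2 * √(p * (1 - p)) * Real.cos α) * t))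
      + lam p ^ k * s ^ 2 * (k * lam p ^ N) - s * R')) := by
  have hl := one_lt_lam hp hp1
  have hp0 : 0 ≤ p := by linarith
  have hcos : 0 < Real.cos (α * N / 2) := by
    apply Real.cos_pos_of_mem_Ioo
    have : 0 ≤ α * N := by positivity
    constructor <;> linarith [Real.pi_pos]
  set D := k * lam p ^ N / Real.cos (α * N / 2) * lam p ^ N
        * Real.exp (-(1 - 2 * √(p * (1 - p)) * Real.cos α) * t) with hD
  set x : ℕ → ℕ := fun i => min (i * (N / k + 1)) N with hx
  have hxN : ∀ i, x i ≤ N := fun i => min_le_right _ _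
  have hm := pairing_one_le hl ξ hkN
  set F : ℕ → ℝ → Config N k → ℝ := fun i s ζ => Real.exp (s * excess p ζ (x i)) with hF
  have hind : (Set.indicator {ζ : Config N k | R < maxDev p ζ} fun _ => (1 : ℝ))
      ≤ ∑ i ∈ Finset.range (k + 1), Real.exp (-(s * R')) • (F i s + F i (-s)) := by
    intro ζ
    simp only [Finset.sum_apply, Pi.smul_apply, Pi.add_apply, smul_eq_mul]
    have hterm : ∀ i ∈ Finset.range (k + 1), 0 ≤ Real.exp (-(s * R')) * (F i s ζ + F i (-s) ζ) := by
      intro i _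
      simp only [hF]
      positivity
    by_cases hζ : ζ ∈ {ζ : Config N k | R < maxDev p ζ}
    · rw [Set.indicator_of_mem hζ]
      obtain ⟨i, hi, hiR⟩ : ∃ i ≤ k, R' < |excess p ζ (x i)| := by
        by_contra! hcon
        refine absurd (show R < maxDev p ζ from hζ) (not_lt.2 ?_)
        refine Finset.sup'_le _ _ fun y hy => ?_
        have hyN : y ≤ N := Nat.lt_succ_iff.1 (Finset.mem_range.1 hy)
        have h1 := abs_excess_le_of_grid hl ζ hk hkN hcon hyN
        exact ((abs_dev_le hp hp1 ζ hyN (by omega)).trans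
          (mul_le_mul_of_nonneg_left h1 (by positivity))).trans hR
      refine le_trans ?_ (Finset.single_le_sum hterm (Finset.mem_range.2 (Nat.lt_succ_iff.2 hi)))
      have h1 : Real.exp (s * R') ≤ F i s ζ + F i (-s) ζ := by
        simp only [hF]
        have hle : Real.exp (s * R') ≤ Real.exp (s * |excess p ζ (x i)|) :=
          Real.exp_le_exp.2 (mul_le_mul_of_nonneg_left hiR.le hs)
        rcases abs_choice (excess p ζ (x i)) with h | h
        · rw [h] at hle
          linarith [Real.exp_pos (-s * excess p ζ (x i))]
        · rw [h, mul_neg, ← neg_mul] at hle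
          linarith [Real.exp_pos (s * excess p ζ (x i))]
      calc (1 : ℝ) = Real.exp (-(s * R')) * Real.exp (s * R') := by
            rw [← Real.exp_add, neg_add_cancel, Real.exp_zero]
        _ ≤ _ := mul_le_mul_of_nonneg_left h1 (Real.exp_pos _).le
    · rw [Set.indicator_of_notMem hζ]
      exact Finset.sum_nonneg hterm
  have hmom : ∀ i, ∀ u : ℝ, |u| = s → semigroup N k p t (F i u) ξ
      ≤ Real.exp (s * D + lam p ^ k * s ^ 2 * (k * lam p ^ N)) := by
    intro i u hu
    have h1 := abs_pairing_exp_walk_sub_le hp hp1 hα hαN hN ξ ht (hxN i)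
    have h2 : pairing p ξ (fun _ => 1) / Real.cos (α * N / 2) * lam p ^ N
      * Real.exp (-(1 - 2 * √(p * (1 - p)) * Real.cos α) * t) ≤ D := by
      rw [hD]
      gcongr
    have h3 := semigroup_exp_excess_le hp hp1 ht ξ (h1.trans h2) (s := u)
      (by rw [abs_mul, hu, abs_of_pos (by positivity)]; exact hs1)
    refine h3.trans (Real.exp_le_exp.2 ?_)
    rw [hu, ← sq_abs u, hu]
    gcongr
  have h := semigroup_mono hp0 hp1.le ht hind ξ
  refine h.trans ?_
  simp only [map_sum, map_smul, map_add, Finset.sum_apply, Pi.smul_apply, Pi.add_apply,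
    smul_eq_mul]
  calc _ ≤ ∑ i ∈ Finset.range (k + 1), Real.exp (-(s * R')) *
        (Real.exp (s * D + lam p ^ k * s ^ 2 * (k * lam p ^ N))
          + Real.exp (s * D + lam p ^ k * s ^ 2 * (k * lam p ^ N))) := by
        refine Finset.sum_le_sum fun i _ => mul_le_mul_of_nonneg_left ?_ (Real.exp_pos _).le
        exact add_le_add (hmom i s (abs_of_nonneg hs)) (hmom i (-s) (by simp [abs_of_nonneg hs]))
    _ = _ := by
        rw [Finset.sum_const, Finset.card_range, nsmul_eq_mul, sub_eq_add_neg (_ + _), Real.exp_add _ (-(s * R'))]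
        push_cast
        ring

/-- The one-time marginals of the exclusion process. -/
theorem IsExclusionProcess.real_mem {p : ℝ} {ξ : Config N k} {Ω : Type*} [MeasurableSpace Ω]
    {P : Measure Ω} [IsProbabilityMeasure P] {η : ℝ → Ω → Config N k}
    (h : IsExclusionProcess p ξ P η) {t : ℝ} (ht : 0 ≤ t) (A : Set (Config N k)) :
    P.real {ω | η t ω ∈ A} = transProb p t ξ A := by
  classical
  have h0 : P.real {ω | η 0 ω = ξ} = 1 := by
    have := h.law 0 (fun _ => 0) (fun _ => ξ) monotone_const rfl rfl
    simpa using this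
  have hm0 : MeasurableSet {ω | η 0 ω = ξ} := h.measurable 0 le_rfl (measurableSet_singleton ξ)
  have h0c : P.real {ω | η 0 ω = ξ}ᶜ = 0 := by
    rw [probReal_compl_eq_one_sub hm0, h0, sub_self]
  have hpt : ∀ ζ, P.real {ω | η t ω = ζ} = transProb p t ξ {ζ} := by
    intro ζ
    -- Two-time law at 0 and t; the condition at time 0 is then dropped because it holds almost
    -- surely.
    have h1 := h.law 1 (fun i => if i = 0 then 0 else t) (fun i => if i = 0 then ξ else ζ)
      (by
        intro a b hab
        by_cases ha : a = 0 <;> by_cases hb : b = 0 <;> simp [ha, hb, ht]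
        omega) rfl rfl
    simp only [Finset.range_one, Finset.prod_singleton, zero_add, one_ne_zero, if_false, if_true,
      sub_zero] at h1
    rw [← h1]
    have e : {ω | ∀ i ≤ 1, η (if i = 0 then 0 else t) ω = if i = 0 then ξ else ζ}
        = {ω | η t ω = ζ} ∩ {ω | η 0 ω = ξ} := by
      ext ω
      simp only [Set.mem_ofPred_eq, Set.mem_inter_iff]
      constructor
      · intro hω
        exact ⟨by simpa using hω 1 le_rfl, by simpa using hω 0 (by omega)⟩
      · rintro ⟨a, b⟩ i hi
        interval_cases i
        · simpa using b
        · simpa using a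
    rw [e]
    have h2 := measureReal_inter_add_sdiff (μ := P) (s := {ω | η t ω = ζ}) hm0
    have h3 : P.real ({ω | η t ω = ζ} \ {ω | η 0 ω = ξ}) = 0 :=
      le_antisymm ((measureReal_mono (fun ω hω => hω.2)).trans h0c.le) measureReal_nonneg
    linarith
  have e1 : {ω | η t ω ∈ A} = ⋃ ζ ∈ (Finset.univ.filter fun ζ => ζ ∈ A), {ω | η t ω = ζ} := by
    ext ω
    simp
  rw [e1, measureReal_biUnion_finset]
  · have e2 : (A.indicator fun _ => (1 : ℝ))
        = ∑ ζ ∈ (Finset.univ.filter fun ζ => ζ ∈ A), Set.indicator {ζ} fun _ => (1 : ℝ) := by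
      funext ζ
      simp only [Finset.sum_apply, Set.indicator_apply, Set.mem_singleton_iff, Finset.sum_ite_eq,
        Finset.mem_filter, Finset.mem_univ, true_and]
    unfold transProb at hpt ⊢
    rw [e2, map_sum, Finset.sum_apply]
    exact Finset.sum_congr rfl fun ζ _ => hpt ζ
  · intro a _ b _ hab
    refine Set.disjoint_left.2 fun ω ha hb => hab ?_
    exact ha.symm.trans hb
  · intro ζ _
    exact h.measurable t ht (measurableSet_singleton ζ)

end Deviation

/-! ### Choice of parameters -/

section Asymptotics

variable {N k : ℕ}

theorem gap_pos {p : ℝ} (hp : 0 < p) (hp1 : p < 1) (hN : 1 ≤ N) : 0 < gap N p := by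
  have hN' : (1 : ℝ) ≤ N := by exact_mod_cast hN
  have h1 : 0 < √(p * (1 - p)) := Real.sqrt_pos.2 (mul_pos hp (by linarith))
  have h2 : 0 < Real.sin (Real.pi / (2 * N)) := by
    apply Real.sin_pos_of_pos_of_lt_pi (by positivity)
    exact div_lt_self Real.pi_pos (by linarith)
  have h3 : 0 ≤ rho p := sq_nonneg _
  unfold gap
  positivity

theorem lam_pow_le {p : ℝ} (hp : 1 / 2 < p) (hp1 : 2 * p - 1 ≤ 1 / 2) {a : ℝ}
    (h : 4 * (N * (2 * p - 1)) ≤ a) : lam p ^ N ≤ Real.exp a := by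
  -- Here λ = 1 + (2p - 1)/(1 - p) and 1 - p ≥ 1/4.
  have h1 : lam p ≤ Real.exp (4 * (2 * p - 1)) := by
    refine le_trans ?_ (Real.add_one_le_exp _)
    unfold lam
    rw [div_le_iff₀ (by linarith)]
    nlinarith
  have h0 : 0 ≤ lam p := div_nonneg (by linarith) (by linarith)
  calc lam p ^ N ≤ Real.exp (4 * (2 * p - 1)) ^ N := pow_le_pow_left₀ h0 h1 N
    _ = Real.exp (N * (4 * (2 * p - 1))) := (Real.exp_nat_mul _ N).symm
    _ ≤ _ := Real.exp_le_exp.2 (by linarith)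

theorem union_bound_le_exp {K a T A B : ℝ} (hK : 1 ≤ K) (ha : 0 ≤ a) (hT1 : a + 3 ≤ T)
    (hT2 : 4 * K ≤ Real.exp T) (hA : A ≤ a * T) (hB : B ≤ 1) :
    (K + 1) * (2 * Real.exp (A + B - T ^ 5)) ≤ Real.exp (-T) := by
  have hT5 : (a + 3) * T ≤ T ^ 5 := by
    calc _ ≤ T * T := mul_le_mul_of_nonneg_right hT1 (by linarith)
      _ = T ^ 2 := (sq T).symm
      _ ≤ T ^ 5 := pow_le_pow_right₀ (by linarith) (by norm_num)
  calc _ = (K + 1) * 2 * Real.exp (A + B - T ^ 5) := by ring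
    _ ≤ Real.exp T * Real.exp (A + B - T ^ 5) :=
        mul_le_mul_of_nonneg_right (by linarith) (Real.exp_pos _).le
    _ ≤ _ := by
        rw [← Real.exp_add, Real.exp_le_exp]
        linarith

theorem exp_neg_mul_le_rpow {p : ℝ} (hp : 0 < p) (hp1 : p < 1) (hN : 1 ≤ N) (hk : 1 ≤ k)
    {ε : ℝ} (hε : 0 ≤ ε) (hε1 : ε ≤ 1) {t : ℝ} (ht : Real.log k / (2 * gap N p) ≤ t) :
    Real.exp (-(1 - 2 * √(p * (1 - p)) * Real.cos ((1 - ε) * Real.pi / N)) * t)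
      ≤ ((k : ℝ) ^ (1 / 2 : ℝ))⁻¹ * (k : ℝ) ^ ε := by
  have hK1 : (1 : ℝ) ≤ k := by exact_mod_cast hk
  have hK0 : (0 : ℝ) < k := by linarith
  have hgap := gap_pos hp hp1 hN
  have hlog : 0 ≤ Real.log k := Real.log_nonneg hK1
  have ht0 : 0 ≤ t := le_trans (by positivity) ht
  have h1 := mul_gap_le (N := N) hp.le hp1.le hN (s := 1 - ε) (by linarith) (by linarith)
  have h2 : Real.log k / 2 ≤ gap N p * t := by
    rw [div_le_iff₀ (by positivity)] at ht
    linarith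
  have h3 : (1 - ε) ^ 2 * (Real.log k / 2)
      ≤ (1 - 2 * √(p * (1 - p)) * Real.cos ((1 - ε) * Real.pi / N)) * t := by
    calc _ ≤ (1 - ε) ^ 2 * (gap N p * t) := mul_le_mul_of_nonneg_left h2 (sq_nonneg _)
      _ = (1 - ε) ^ 2 * gap N p * t := by ring
      _ ≤ _ := mul_le_mul_of_nonneg_right h1 ht0
  have e : ((k : ℝ) ^ (1 / 2 : ℝ))⁻¹ * (k : ℝ) ^ ε = Real.exp (Real.log k * (-(1 / 2) + ε)) := by
    rw [← Real.rpow_def_of_pos hK0, Real.rpow_add hK0, Real.rpow_neg hK0.le]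
  rw [e, Real.exp_le_exp]
  -- (1 - ε)²/2 ≥ 1/2 - ε, the dropped term being ε²/2.
  have h4 := mul_nonneg hlog (sq_nonneg ε)
  linarith

theorem transProb_maxDev_le_exp {p : ℝ} (hp : 1 / 2 < p) (hp1 : p < 1) (hk : 1 ≤ k) (hkN : k ≤ N)
    (hN : 2 ≤ N) (ξ : Config N k) {ε : ℝ} (hε : 0 < ε) (hε1 : ε ≤ 1 / 10)
    (hlam : lam p ^ N ≤ (k : ℝ) ^ ε)
    (hT1 : (Real.cos ((1 - ε) * Real.pi / 2))⁻¹ + 3 ≤ (k : ℝ) ^ ε)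
    (hT2 : 4 * (k : ℝ) ≤ Real.exp ((k : ℝ) ^ ε)) {t : ℝ} (ht : Real.log k / (2 * gap N p) ≤ t) :
    transProb p t ξ {ζ | (k : ℝ) ^ (1 / 2 + 10 * ε) < maxDev p ζ}
      ≤ Real.exp (-(k : ℝ) ^ ε) := by
  have hp0 : 0 ≤ p := by linarith
  have hl := one_lt_lam hp hp1
  have hK1 : (1 : ℝ) ≤ k := by exact_mod_cast hk
  have hK0 : (0 : ℝ) < k := by linarith
  have hN0 : (0 : ℝ) < N := by exact_mod_cast (by omega : 0 < N)
  have hgap := gap_pos (by linarith) hp1 (by omega : 1 ≤ N)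
  have hlog : 0 ≤ Real.log k := Real.log_nonneg hK1
  have ht0 : 0 ≤ t := le_trans (by positivity) ht
  set c0 := Real.cos ((1 - ε) * Real.pi / 2) with hc0
  have hc0pos : 0 < c0 := by
    apply Real.cos_pos_of_mem_Ioo
    constructor <;> nlinarith [Real.pi_pos]
  set α := (1 - ε) * Real.pi / N with hα
  have hα0 : 0 ≤ α := div_nonneg (mul_nonneg (by linarith) Real.pi_pos.le) hN0.le
  have hαN : α * N = (1 - ε) * Real.pi := by rw [hα]; field_simp
  set T := (k : ℝ) ^ ε with hT
  set S := (k : ℝ) ^ (1 / 2 : ℝ) with hS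
  have hT0 : 0 < T := Real.rpow_pos_of_pos hK0 _
  have hS0 : 0 < S := Real.rpow_pos_of_pos hK0 _
  have hT3 : 3 ≤ T := by linarith [inv_pos.2 hc0pos]
  have hS1 : 1 ≤ S := Real.one_le_rpow hK1 (by norm_num)
  have hSS : S * S = k := by rw [hS, ← Real.rpow_add hK0]; norm_num
  have hTn : ∀ n : ℕ, (k : ℝ) ^ (n * ε) = T ^ n := by
    intro n
    rw [mul_comm, Real.rpow_mul hK0.le, Real.rpow_natCast]
  clear_value T S c0
  have hlk : lam p ^ k ≤ T := (pow_le_pow_right₀ hl.le hkN).trans hlam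
  have hR : lam p ^ N * (S * T ^ 7 + 2 * lam p ^ N * lam p ^ N)
      ≤ (k : ℝ) ^ (1 / 2 + 10 * ε) := by
    have e : (k : ℝ) ^ (1 / 2 + 10 * ε) = S * T ^ 10 := by
      rw [Real.rpow_add hK0, ← hTn 10]
      norm_num only [hS, Nat.cast_ofNat]
    rw [e]
    have h1 : T ^ 2 ≤ S * T ^ 7 := by
      calc T ^ 2 ≤ T ^ 7 := pow_le_pow_right₀ (by linarith) (by norm_num)
        _ ≤ _ := le_mul_of_one_le_left (by positivity) hS1
    have hL0 : 0 ≤ lam p ^ N := by positivity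
    calc _ ≤ T * (S * T ^ 7 + 2 * T * T) := by gcongr
      _ ≤ T * (3 * (S * T ^ 7)) := by
          apply mul_le_mul_of_nonneg_left _ hT0.le; nlinarith
      _ = 3 * (S * T ^ 8) := by ring
      _ ≤ T ^ 2 * (S * T ^ 8) := by
          apply mul_le_mul_of_nonneg_right _ (by positivity); nlinarith
      _ = _ := by ring
  -- With S = √k and T = k^ε, this makes the variance term at most 1 and the mean term at most T/c0,
  -- while the threshold S T^7 contributes T^5. Converting the excess back to heights costs up to
  -- T^3 more, whence the exponent 1/2 + 10ε.
  set s := (S * T ^ 2)⁻¹ with hs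
  have hs0 : 0 ≤ s := by positivity
  have hs1 : lam p ^ k * s ≤ 1 := by
    rw [hs, ← div_eq_mul_inv, div_le_one (by positivity)]
    calc _ ≤ T := hlk
      _ ≤ T ^ 2 := by nlinarith
      _ ≤ _ := le_mul_of_one_le_left (by positivity) hS1
  have hsS : s * (S * T ^ 2) = 1 := inv_mul_cancel₀ (by positivity)
  clear_value s
  have key := transProb_maxDev_le hp hp1 ht0 hk hkN hN ξ hα0
    (by rw [hαN]; nlinarith [Real.pi_pos]) hs0 hs1 hR
  refine key.trans ?_
  rw [hαN]
  have hdecay : Real.exp (-(1 - 2 * √(p * (1 - p)) * Real.cos α) * t) ≤ S⁻¹ * T :=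
    hS ▸ hT ▸ exp_neg_mul_le_rpow (by linarith) hp1 (by omega) hk hε.le (by linarith) ht
  have hD : s * (k * lam p ^ N / c0 * lam p ^ N
      * Real.exp (-(1 - 2 * √(p * (1 - p)) * Real.cos α) * t)) ≤ c0⁻¹ * T := by
    calc _ ≤ s * (k * T / c0 * T * (S⁻¹ * T)) := by gcongr
      _ = c0⁻¹ * T * (s * (S * T ^ 2)) * (S⁻¹ * S) := by rw [← hSS]; ring
      _ = c0⁻¹ * T := by rw [hsS, inv_mul_cancel₀ hS0.ne', mul_one, mul_one]
  have hV : lam p ^ k * s ^ 2 * (k * lam p ^ N) ≤ 1 := by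
    calc _ ≤ T * s ^ 2 * (k * T) := by gcongr
      _ ≤ (T * s ^ 2 * (k * T)) * T ^ 2 :=
        le_mul_of_one_le_right (by positivity) (one_le_pow₀ (by linarith))
      _ = (s * (S * T ^ 2)) ^ 2 := by rw [← hSS]; ring
      _ = 1 := by rw [hsS, one_pow]
  have hsR : s * (S * T ^ 7) = T ^ 5 := by
    calc _ = s * (S * T ^ 2) * T ^ 5 := by ring
      _ = _ := by rw [hsS, one_mul]
  rw [hsR, ← hc0]
  exact union_bound_le_exp hK1 (inv_pos.2 hc0pos).le hT1 hT2 hD hV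

end Asymptotics

end Exclusion

/-! ### The main theorem -/

theorem proposition7p5 (k : ℕ → ℕ) (p : ℕ → ℝ)
    (hk : ∀ N, 2 ≤ N → 1 ≤ k N ∧ 2 * k N ≤ N)
    (hp : ∀ N, 2 ≤ N → 1 / 2 < p N ∧ p N ≤ 1)
    (hbias : Tendsto (fun N : ℕ => (N : ℝ) * (2 * p N - 1) / Real.log (k N)) atTop (𝓝 0))
    (hkinf : Tendsto k atTop atTop)
    (c : ℝ) (hc : 0 < c) :
    ∃ c' : ℝ, 0 < c' ∧ ∀ᶠ N : ℕ in atTop,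
      ∀ t : ℝ, Real.log (k N) / (2 * Exclusion.gap N (p N)) ≤ t →
      ∀ ξ : Exclusion.Config N (k N), Exclusion.IsMaxConfig ξ ∨ Exclusion.IsMinConfig ξ →
        -- the bound for the law at time `t`
        Exclusion.transProb (p N) t ξ
            {ζ | (k N : ℝ) ^ (1 / 2 + c) < Exclusion.maxDev (p N) ζ}
          ≤ Real.exp (-(k N : ℝ) ^ c') ∧
        -- the same bound for every realization of the process, on any probability space
        ∀ (Ω : Type*) [MeasurableSpace Ω] (P : Measure Ω) [IsProbabilityMeasure P]
          (η : ℝ → Ω → Exclusion.Config N (k N)),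
          Exclusion.IsExclusionProcess (p N) ξ P η →
          P.real {ω | (k N : ℝ) ^ (1 / 2 + c) < Exclusion.maxDev (p N) (η t ω)}
            ≤ Real.exp (-(k N : ℝ) ^ c') := by
  set ε := min c 1 / 10 with hε
  have hε0 : 0 < ε := by positivity
  have hε1 : ε ≤ 1 / 10 := by linarith [min_le_right c 1]
  have hεc : 10 * ε ≤ c := by linarith [min_le_left c 1]
  refine ⟨ε, hε0, ?_⟩
  have hkR : Tendsto (fun N => (k N : ℝ)) atTop atTop := tendsto_natCast_atTop_atTop.comp hkinf
  have hpow : Tendsto (fun N => (k N : ℝ) ^ ε) atTop atTop := (tendsto_rpow_atTop hε0).comp hkR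
  have hlogpow : ∀ᶠ N in atTop, Real.log (k N) ≤ 1 / 2 * (k N : ℝ) ^ ε := by
    have h := hkR.eventually ((isLittleO_log_rpow_atTop hε0).bound (by norm_num : (0 : ℝ) < 1 / 2))
    filter_upwards [h] with N hN
    rw [Real.norm_eq_abs, Real.norm_eq_abs,
      abs_of_nonneg (Real.rpow_nonneg (Nat.cast_nonneg _) _)] at hN
    exact (le_abs_self _).trans hN
  -- The 4 matches the constant in `lam_pow_le`, so that λ^N ≤ k^ε.
  have hb := hbias.eventually (gt_mem_nhds (show (0 : ℝ) < ε / 4 by positivity))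
  filter_upwards [hb, hlogpow, hkR.eventually_ge_atTop 2, eventually_ge_atTop 2,
    hpow.eventually_ge_atTop ((Real.cos ((1 - ε) * Real.pi / 2))⁻¹ + 3),
    hpow.eventually_ge_atTop (2 * Real.log 4)] with N hbN hlogN hk2 hN hT1 hT3
  intro t ht ξ _
  have hkN : k N ≤ N := by have := (hk N hN).2; omega
  have hK0 : (0 : ℝ) < k N := by linarith
  have hlog : 0 < Real.log (k N) := Real.log_pos (by linarith)
  have hNR : (0 : ℝ) < N := by positivity
  have hbias' : N * (2 * p N - 1) ≤ ε / 4 * Real.log (k N) := ((div_lt_iff₀ hlog).1 hbN).le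
  -- Turns the bias condition into 2p - 1 ≤ ε/4, which in particular forces p < 1.
  have hlogle : Real.log (k N) ≤ N := by
    have h1 := Real.log_le_sub_one_of_pos hK0
    have h2 : (k N : ℝ) ≤ N := by exact_mod_cast hkN
    linarith
  have hp2 : 2 * p N - 1 ≤ 1 / 2 := by
    have h1 : N * (2 * p N - 1) ≤ N * (ε / 4) := by nlinarith
    have := le_of_mul_le_mul_left h1 hNR
    linarith
  have hp1 : p N < 1 := by linarith
  have hlam : Exclusion.lam (p N) ^ N ≤ (k N : ℝ) ^ ε := by
    rw [Real.rpow_def_of_pos hK0]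
    exact Exclusion.lam_pow_le (hp N hN).1 hp2 (by linarith)
  have hT2 : 4 * (k N : ℝ) ≤ Real.exp ((k N : ℝ) ^ ε) := by
    rw [← Real.exp_log (by positivity : 0 < 4 * (k N : ℝ)), Real.exp_le_exp,
      Real.log_mul (by norm_num) hK0.ne']
    linarith
  have ht0 : 0 ≤ t := by
    have := Exclusion.gap_pos (by linarith [(hp N hN).1]) hp1 (by omega : 1 ≤ N)
    exact le_trans (by positivity) ht
  have key := Exclusion.transProb_maxDev_le_exp (hp N hN).1 hp1 (hk N hN).1 hkN hN ξ hε0 hε1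
    hlam hT1 hT2 ht
  have hle : (k N : ℝ) ^ (1 / 2 + 10 * ε) ≤ (k N : ℝ) ^ (1 / 2 + c) :=
    Real.rpow_le_rpow_of_exponent_le (by linarith) (by linarith)
  have hmain : Exclusion.transProb (p N) t ξ
      {ζ | (k N : ℝ) ^ (1 / 2 + c) < Exclusion.maxDev (p N) ζ} ≤ Real.exp (-(k N : ℝ) ^ ε) := by
    refine le_trans (Exclusion.semigroup_mono (by linarith [(hp N hN).1]) hp1.le ht0 ?_ ξ) key
    exact Set.indicator_le_indicator_of_subset (fun ζ hζ => lt_of_le_of_lt hle hζ)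
      (fun _ => zero_le_one)
  refine ⟨hmain, ?_⟩
  intro Ω _ P _ η hη
  exact (hη.real_mem ht0 {ζ | (k N : ℝ) ^ (1 / 2 + c) < Exclusion.maxDev (p N) ζ}).le.trans hmain
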